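/- Conventions. A state of a unital C*-algebra is a positive linear functional taking the value $1$ at the unit; $\mathscr S(\mathfrak B)$ is the state space, $\mathrm{sa}(\mathfrak B)$ the self-adjoint part. A seminorm $L$ on a dense subspace of $\mathrm{sa}(\mathfrak B)$ is extended by $\infty$ off its domain. The pair $(\mathfrak B,L)$ is a \emph{compact quantum metric space} if $L$ is such a seminorm, its domain contains the unit and is dense, $L(a)=0$ exactly for $a\in\mathbb R1_{\mathfrak B}$, $L$ is lower semicontinuous for the norm, and $\mathrm{mk}_L(\varphi,\psi)=\sup\{|\varphi(a)-\psi(a)|: a \in \mathrm{sa}(\mathfrak B),\ L(a)\le1\}$ is a metric that induces the weak* topology of $\mathscr S(\mathfrak B)$. It is \emph{$C$-quasi-Leibniz} ($C\ge1$) if $L(\frac{ab+ba}{2})$ and $L(\frac{ab-ba}{2i})$ are at most $C(L(a)\|b\|+L(b)\|a\|)$ for all $a,b\in\mathrm{sa}(\mathfrak B)$. Two pairs $(\mathfrak B,L)$, $(\mathfrak B',L')$ are \emph{fully quantum isometric} if there is a *-isomorphism $\pi:\mathfrak B\to\mathfrak B'$ with $L'\circ\pi=L$ on $\mathrm{sa}(\mathfrak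 B)$. A \emph{bridge} between $(\mathfrak B,L)$ and $(\mathfrak B',L')$ is a tuple $(\mathfrak D,\pi,\pi',\omega)$ of a unital C*-algebra $\mathfrak D$, unital *-monomorphisms $\pi:\mathfrak B\to\mathfrak D$, $\pi':\mathfrak B'\to\mathfrak D$ and $\omega\in\mathfrak D$ such that $\mathscr S_1=\{\varphi\in\mathscr S(\mathfrak D):\varphi(1-\omega^*\omega)=\varphi(1-\omega\omega^*)=0\}\ne\emptyset$. Its length is the maximum of the Hausdorff distance of $\mathscr S(\mathfrak B)$ and $\{\varphi\circ\pi:\varphi\in\mathscr S_1\}$ for $\mathrm{mk}_L$, the Hausdorff distance of $\mathscr S(\mathfrak B')$ and $\{\varphi\circ\pi':\varphi\in\mathscr S_1\}$ for $\mathrm{mk}_{L'}$, and the Hausdorff distance of the unit balls $\{L\le1\}\times\{0\}$ and $\{0\}\times\{L'\le1\}$ for the seminorm $(a,b)\mapsto\|\pi(a)\omega-\omega\pi'(b)\|$ on $\mathfrak B\oplus\mathfrak B'$. The quantum Gromov-Hausdorff \emph{propinquity} $\Lambda$ (on $2$-quasi-Leibniz compact quantum metric spaces) is the infimum, over all finite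 chains of bridges through $2$-quasi-Leibniz compact quantum metric spaces from one space to the other, of the sum of the lengths of the bridges. Theorem. Let $(X,d)$ be a nonempty compact metric space, $\mathfrak A$ a unital C*-algebra with a faithful tracial state $\tau$, and $\mathcal I=(\mathfrak A_n)_{n\in\mathbb N}$ finite-dimensional C*-subalgebras with $\mathfrak A_0=\mathbb C1_{\mathfrak A}\subseteq\mathfrak A_1\subseteq\mathfrak A_2\subseteq\cdots$ and $\mathfrak A=\overline{\bigcup_n\mathfrak A_n}$. Let $\beta(n)>0$ with $\beta(n)\to0$. For each $n$ there is a unique conditional expectation (contractive linear map onto $\mathfrak A_n$ that fixes $\mathfrak A_n$ pointwise) $E_n:\mathfrak A\to\mathfrak A_n$ with $\tau\circ E_n=\tau$; put $E^X_n(f)(x)=E_n(f(x))$ for $f\in C(X,\mathfrak A)$. For $f\in C(X,\mathfrak A)$ (or $f\in C(X)$) let $l(f)=\sup_{x, y}\|f(x)-f(y)\|/d(x,y)$ (with $0/0=0$), for $a\in\mathfrak A$ let $L^\beta(a)=\sup_n\|a-E_n(a)\|/\beta(n)$, and for $f\in C(X,\mathfrak A)$ let $$L(f)=l(f)+\sup_{n\in\mathbb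 N}\frac{\|f-E^X_n(f)\|}{\beta(n)}.$$ All these take values in $[0,\infty]$, with $0\cdot\infty=0$; as seminorms of pairs they are restricted to self-adjoint elements. Then: (1) for each $n$, $(C(X,\mathfrak A_n),L)$ is a $2$-quasi-Leibniz compact quantum metric space, and $L(f)=l(f)+\max_{0\le k\le n}\|f-E^X_k(f)\|/\beta(k)$ for all self-adjoint $f\in C(X,\mathfrak A_n)$; (2) $(C(X,\mathfrak A),L)$ is a $2$-quasi-Leibniz compact quantum metric space; (3) $\Lambda\big((C(X,\mathfrak A),L),(C(X,\mathfrak A_n),L)\big)\le\beta(n)$ for each $n$, and thus this distance tends to $0$ as $n\to\infty$; (4) if $\mathfrak A=\mathbb C$, then $(C(X,\mathfrak A),L)$ is fully quantum isometric to $(C(X),l)$; (5) if $X$ is a single point, then $(C(X,\mathfrak A),L)$ is fully quantum isometric to $(\mathfrak A,L^\beta)$; (6) if $\dim\mathfrak A<\infty$, $\mathfrak A_n=\mathfrak A$ for all $n\ge1$ and $\beta(0)=r>0$, then $(C(X,\mathfrak A),L)$ is fully quantum isometric to $C(X,\mathfrak A)$ with the seminorm $f\mapsto l(f)+\|f-E^X_0(f)\|/r$.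 Furthermore, let $C(X)\otimes\mathfrak A$ be the C*-algebraic tensor product, i.e. the completion of the algebraic tensor product in any C*-norm. There is a unique *-isomorphism $\pi:C(X)\otimes\mathfrak A\to C(X,\mathfrak A)$ with $\pi(f\otimes a)(x)=f(x)a$. Put $L^\otimes=L\circ\pi$, and let $C(X)\otimes\mathfrak A_n\subseteq C(X)\otimes\mathfrak A$ be the C*-subalgebra generated by the $f\otimes a$ with $f\in C(X)$, $a\in\mathfrak A_n$. Then (1)-(5), except for the formula in (1), hold with $C(X,\mathfrak A)$, $C(X,\mathfrak A_n)$, $L$ replaced by $C(X)\otimes\mathfrak A$, $C(X)\otimes\mathfrak A_n$, $L^\otimes$, and (6) holds with only the first pair $(C(X,\mathfrak A),L)$ replaced by $(C(X)\otimes\mathfrak A,L^\otimes)$. Moreover, for all $f\in C(X)$ and $a\in\mathfrak A$, $$L^\otimes(f\otimes a)=l(f)\,\|a\|+L^\beta(a)\,\|f\|,$$ and thus $L^\otimes(1\otimes a)=L^\beta(a)$ and $L^\otimes(f\otimes1)=l(f)$. -/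

import Mathlib

open Filter Topology
open scoped ENNReal NNReal ComplexOrder TensorProduct

universe u v w

noncomputable section

/-! ### States, Lip-norms and compact quantum metric spaces -/

section LipNorms

variable {A : Type u} [CStarAlgebra A]

/-- A state: a positive linear functional that takes the value one at the unit. -/
def IsState (φ : WeakDual ℂ A) : Prop :=
  φ 1 = 1 ∧ ∀ a : A, 0 ≤ φ (star a * a)

variable (A) in
/-- The state space. As a subtype of `WeakDual ℂ A` it carries the weak* topology. -/
abbrev StateSpace : Type u := {φ : WeakDual ℂ A // IsState φ}

variable (A) in
/-- The weak* topology of the state space: the subspace topology from `WeakDual ℂ A`. It is named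
here so that it cannot be confused with the topology of a metric on the state space. -/
abbrev weakStarTopology : TopologicalSpace (StateSpace A) :=
  instTopologicalSpaceSubtype

/-- A state is faithful. -/
def StateSpace.IsFaithful (τ : StateSpace A) : Prop :=
  ∀ a : A, τ.1 (star a * a) = 0 → a = 0

/-- A state is tracial. -/
def StateSpace.IsTracial (τ : StateSpace A) : Prop :=
  ∀ a b : A, τ.1 (a * b) = τ.1 (b * a)

/-- The Jordan product `(ab + ba) / 2` of two self-adjoint elements. -/
def jordanProd (a b : selfAdjoint A) : selfAdjoint A :=
  ⟨(2⁻¹ : ℂ) • ((a : A) * b + b * a), by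
    rw [selfAdjoint.mem_iff]
    simp [star_smul, star_add, star_mul, selfAdjoint.star_val_eq, add_comm]⟩

/-- The Lie product `(ab - ba) / (2i)` of two self-adjoint elements. -/
def lieProd (a b : selfAdjoint A) : selfAdjoint A :=
  ⟨((2 * Complex.I)⁻¹ : ℂ) • ((a : A) * b - b * a), by
    rw [selfAdjoint.mem_iff]
    simp only [star_smul, star_sub, star_mul, selfAdjoint.star_val_eq]
    rw [← neg_sub ((a : A) * b), smul_neg, ← neg_smul]
    congr 1
    simp⟩

/-- The Monge-Kantorovich metric of `L`. A seminorm on a subspace of the self-adjoint part is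
encoded as an extended seminorm, with value `∞` exactly off its domain. -/
def mkDist (L : selfAdjoint A → ℝ≥0∞) (φ ψ : StateSpace A) : ℝ≥0∞ :=
  ⨆ (a : selfAdjoint A) (_ : L a ≤ 1), ‖φ.1 (a : A) - ψ.1 (a : A)‖ₑ

/-- `L` is a Lip-norm, that is, `(A, L)` is a compact quantum metric space. -/
structure IsLipNorm (L : selfAdjoint A → ℝ≥0∞) : Prop where
  add_le : ∀ a b, L (a + b) ≤ L a + L b
  smul_eq : ∀ (r : ℝ) (a), L (r • a) = ENNReal.ofReal |r| * L a
  dense_dom : Dense {a | L a < ∞}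
  eq_zero_iff : ∀ a, L a = 0 ↔ ∃ r : ℝ, a = r • (1 : selfAdjoint A)
  metrizes : ∃ m : MetricSpace (StateSpace A),
    (∀ φ ψ, mkDist L φ ψ = ENNReal.ofReal (m.dist φ ψ)) ∧
    m.toUniformSpace.toTopologicalSpace = weakStarTopology A
  lsc : LowerSemicontinuous L

/-- `L` is `C`-quasi-Leibniz. -/
def IsQuasiLeibniz (C : ℝ≥0) (L : selfAdjoint A → ℝ≥0∞) : Prop :=
  1 ≤ C ∧
  (∀ a b, L (jordanProd a b) ≤ C * (L a * ‖(b : A)‖ₑ + L b * ‖(a : A)‖ₑ)) ∧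
  (∀ a b, L (lieProd a b) ≤ C * (L a * ‖(b : A)‖ₑ + L b * ‖(a : A)‖ₑ))

end LipNorms

/-- A unital C*-algebra together with an extended-valued function on its self-adjoint part. -/
structure QPair where
  carrier : Type u
  [alg : CStarAlgebra carrier]
  L : selfAdjoint carrier → ℝ≥0∞

attribute [instance] QPair.alg

/-- The pair of a unital C*-algebra and the restriction to its self-adjoint part of a function
that is given on the whole algebra. -/
def QPair.of (A : Type u) [CStarAlgebra A] (L : A → ℝ≥0∞) : QPair.{u} where
  carrier := A
  L := fun a => L a

/-- `(A, L)` is a `C`-quasi-Leibniz compact quantum metric space. -/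
def QPair.IsCQMS (C : ℝ≥0) (P : QPair.{u}) : Prop :=
  IsLipNorm P.L ∧ IsQuasiLeibniz C P.L

/-- Full quantum isometry: a *-isomorphism that intertwines the seminorms. -/
def QPair.FullyQuantumIsometric (P : QPair.{u}) (Q : QPair.{v}) : Prop :=
  ∃ π : P.carrier ≃⋆ₐ[ℂ] Q.carrier,
    ∀ a : selfAdjoint P.carrier, Q.L ⟨π (a : P.carrier), IsSelfAdjoint.map a.2 π⟩ = P.L a

/-! ### Bridges and the quantum Gromov-Hausdorff propinquity -/

/-- The Hausdorff distance of two sets for an extended pseudo-distance `d`. -/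
def hausDist {S : Type*} (d : S → S → ℝ≥0∞) (s t : Set S) : ℝ≥0∞ :=
  max (⨆ x ∈ s, ⨅ y ∈ t, d x y) (⨆ y ∈ t, ⨅ x ∈ s, d x y)

/-- The 1-level set of an element of a unital C*-algebra. -/
def levelSet {D : Type u} [CStarAlgebra D] (ω : D) : Set (StateSpace D) :=
  {φ | φ.1 (1 - star ω * ω) = 0 ∧ φ.1 (1 - ω * star ω) = 0}

/-- A bridge between the underlying unital C*-algebras of two pairs. -/
structure Bridge (P Q : QPair.{u}) where
  D : Type u
  [alg : CStarAlgebra D]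
  pivot : D
  levelSet_nonempty : (levelSet pivot).Nonempty
  left : P.carrier →⋆ₐ[ℂ] D
  right : Q.carrier →⋆ₐ[ℂ] D
  left_injective : Function.Injective left
  right_injective : Function.Injective right

attribute [instance] Bridge.alg

namespace Bridge

variable {P Q : QPair.{u}}

/-- The image of a set of states under the dual map of a unital *-morphism. -/
def dualImage {A D : Type u} [CStarAlgebra A] [CStarAlgebra D] (π : A →⋆ₐ[ℂ] D)
    (S : Set (StateSpace D)) : Set (StateSpace A) :=
  {ψ | ∃ φ ∈ S, ∀ a, ψ.1 a = φ.1 (π a)}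

/-- The height of a bridge. -/
def height (γ : Bridge P Q) : ℝ≥0∞ :=
  max (hausDist (mkDist P.L) Set.univ (dualImage γ.left (levelSet γ.pivot)))
    (hausDist (mkDist Q.L) Set.univ (dualImage γ.right (levelSet γ.pivot)))

/-- The bridge seminorm on the direct sum. -/
def bn (γ : Bridge P Q) (p : P.carrier × Q.carrier) : ℝ≥0∞ :=
  ‖γ.left p.1 * γ.pivot - γ.pivot * γ.right p.2‖ₑ

/-- The reach of a bridge: the Hausdorff distance, for the pseudo-distance of the bridge seminorm
on the direct sum, of the two unit balls of the Lip-norms. -/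
def reach (γ : Bridge P Q) : ℝ≥0∞ :=
  hausDist (fun p q => γ.bn (p - q))
    {p | ∃ a : selfAdjoint P.carrier, P.L a ≤ 1 ∧ p = ((a : P.carrier), 0)}
    {p | ∃ b : selfAdjoint Q.carrier, Q.L b ≤ 1 ∧ p = (0, (b : Q.carrier))}

/-- The length of a bridge. -/
def length (γ : Bridge P Q) : ℝ≥0∞ := max γ.height γ.reach

end Bridge

/-- A trek: a finite nonempty chain of bridges through `C`-quasi-Leibniz compact quantum metric
spaces. -/
inductive Trek (C : ℝ≥0) : QPair.{u} → QPair.{u} → Type (u + 1)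
  | single {P Q : QPair.{u}} (hP : P.IsCQMS C) (hQ : Q.IsCQMS C) (γ : Bridge P Q) : Trek C P Q
  | cons {P Q R : QPair.{u}} (hP : P.IsCQMS C) (γ : Bridge P Q) (Γ : Trek C Q R) : Trek C P R

/-- The length of a trek: the sum of the lengths of its bridges. -/
def Trek.length {C : ℝ≥0} : {P Q : QPair.{u}} → Trek C P Q → ℝ≥0∞
  | _, _, .single _ _ γ => γ.length
  | _, _, .cons _ γ Γ => γ.length + Γ.length

/-- The quantum Gromov-Hausdorff propinquity on the class of `C`-quasi-Leibniz compact quantum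
metric spaces: the infimum of the lengths of all treks. -/
def propinquity (C : ℝ≥0) (P Q : QPair.{u}) : ℝ≥0∞ :=
  ⨅ Γ : Trek C P Q, Γ.length

/-! ### Conditional expectations and the seminorms -/

section CondExp

variable {A : Type v} [CStarAlgebra A]

/-- A finite-dimensional *-subalgebra is closed, hence a C*-subalgebra. -/
instance isClosed_of_finiteDimensional (B : StarSubalgebra ℂ A) [FiniteDimensional ℂ B] :
    IsClosed (B : Set A) := by
  have : FiniteDimensional ℂ (Subalgebra.toSubmodule B.toSubalgebra) :=
    inferInstanceAs (FiniteDimensional ℂ B)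
  exact Submodule.closed_of_finiteDimensional (Subalgebra.toSubmodule B.toSubalgebra)

/-- A conditional expectation onto `B`: a contractive linear map to `B` that fixes `B`.
(A contractive linear map is continuous, so continuity is no further restriction.) -/
structure IsCondExp (B : StarSubalgebra ℂ A) (E : A →L[ℂ] B) : Prop where
  proj : ∀ b : B, E b = b
  contractive : ∀ a : A, ‖E a‖ ≤ ‖a‖

/-- A conditional expectation onto `B` that preserves the state `τ`. -/
def IsPreservingCondExp (τ : StateSpace A) (B : StarSubalgebra ℂ A) (E : A →L[ℂ] B) : Prop :=
  IsCondExp B E ∧ ∀ a : A, τ.1 (E a : A) = τ.1 a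

open Classical in
/-- The `τ`-preserving conditional expectation onto `B` (zero if there is none). -/
def condExp (τ : StateSpace A) (B : StarSubalgebra ℂ A) : A →L[ℂ] B :=
  if h : ∃ E : A →L[ℂ] B, IsPreservingCondExp τ B E then h.choose else 0

/-- The seminorm `a ↦ sup_n ‖a - E_n(a)‖ / β(n)` of an AF algebra. -/
def afSeminorm (τ : StateSpace A) (I : ℕ → StarSubalgebra ℂ A) (β : ℕ → ℝ) (a : A) : ℝ≥0∞ :=
  ⨆ n, ‖a - (condExp τ (I n) a : A)‖ₑ / ENNReal.ofReal (β n)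

variable {X : Type u} [MetricSpace X]

/-- The Lipschitz seminorm. In `ℝ≥0∞` one has `0 / 0 = 0`. -/
def lipSeminorm (f : C(X, A)) : ℝ≥0∞ :=
  ⨆ (x : X) (y : X), ‖f x - f y‖ₑ / edist x y

/-- The inclusion of `C(X, B)` into `C(X, A)`. -/
def inclX (B : StarSubalgebra ℂ A) (f : C(X, B)) : C(X, A) :=
  ⟨fun x => (f x : A), continuous_subtype_val.comp f.continuous⟩

/-- The map `C(X, A) → C(X, B)` that applies the conditional expectation pointwise. -/
def condExpX (τ : StateSpace A) (B : StarSubalgebra ℂ A) (f : C(X, A)) : C(X, B) :=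
  ⟨fun x => condExp τ B (f x), (condExp τ B).continuous.comp f.continuous⟩

variable [CompactSpace X]

/-- The seminorm `f ↦ l(f) + ‖f - E(f)‖ / r`, for a map `E` from `C(X, A)` to `C(X, B)`. -/
def homSeminorm {B : StarSubalgebra ℂ A} (E : C(X, A) → C(X, B)) (r : ℝ) (f : C(X, A)) : ℝ≥0∞ :=
  lipSeminorm f + ‖f - inclX B (E f)‖ₑ / ENNReal.ofReal r

/-- The seminorm `f ↦ l(f) + sup_n ‖f - E_n(f)‖ / β(n)` on `C(X, A)`. -/
def ahSeminorm (τ : StateSpace A) (I : ℕ → StarSubalgebra ℂ A) (β : ℕ → ℝ) (f : C(X, A)) :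
    ℝ≥0∞ :=
  lipSeminorm f + ⨆ n, ‖f - inclX (I n) (condExpX τ (I n) f)‖ₑ / ENNReal.ofReal (β n)

variable (X) in
/-- The pair `(C(X, A), L)`. -/
def contPair (τ : StateSpace A) (I : ℕ → StarSubalgebra ℂ A) (β : ℕ → ℝ) : QPair.{max u v} :=
  QPair.of C(X, A) (ahSeminorm τ I β)

variable (X) in
/-- The pair `(C(X, B), L)`, where `L` is restricted to `C(X, B) ⊆ C(X, A)`. -/
def contSubPair (τ : StateSpace A) (I : ℕ → StarSubalgebra ℂ A) (β : ℕ → ℝ)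
    (B : StarSubalgebra ℂ A) [IsClosed (B : Set A)] : QPair.{max u v} :=
  QPair.of C(X, B) (fun f => ahSeminorm τ I β (inclX B f))

end CondExp

/-! ### C*-tensor products -/

/-- A C*-algebraic tensor product: a completion of the algebraic tensor product (with its
*-algebra structure) in some C*-norm, that is, a unital C*-algebra that contains the algebraic
tensor product as a dense *-subalgebra. -/
structure CStarTensor (A : Type u) (B : Type v) [CStarAlgebra A] [CStarAlgebra B] where
  carrier : Type w
  [alg : CStarAlgebra carrier]
  ι : (A ⊗[ℂ] B) →⋆ₐ[ℂ] carrier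
  injective : Function.Injective ι
  denseRange : DenseRange ι

attribute [instance] CStarTensor.alg

/-- The C*-subalgebra `A ⊗ S` of `A ⊗ B`, generated by the elementary tensors `a ⊗ s` with `s` in
the *-subalgebra `S` of `B`. -/
def CStarTensor.sub {A : Type u} {B : Type v} [CStarAlgebra A] [CStarAlgebra B]
    (T : CStarTensor.{u, v, w} A B) (S : StarSubalgebra ℂ B) : StarSubalgebra ℂ T.carrier :=
  (StarAlgebra.adjoin ℂ {t | ∃ (a : A) (s : B), s ∈ S ∧ t = T.ι (a ⊗ₜ[ℂ] s)}).topologicalClosure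

instance CStarTensor.isClosed_sub {A : Type u} {B : Type v} [CStarAlgebra A] [CStarAlgebra B]
    (T : CStarTensor.{u, v, w} A B) (S : StarSubalgebra ℂ B) :
    IsClosed (T.sub S : Set T.carrier) :=
  StarSubalgebra.isClosed_topologicalClosure _

section Tensor

variable {A : Type v} [CStarAlgebra A] {X : Type u} [MetricSpace X] [CompactSpace X]

/-- `π` is the canonical *-isomorphism from `C(X) ⊗ A` to `C(X, A)`. -/
def IsCanonical (T : CStarTensor.{u, v, w} C(X, ℂ) A) (π : T.carrier ≃⋆ₐ[ℂ] C(X, A)) : Prop :=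
  ∀ (f : C(X, ℂ)) (a : A) (x : X), π (T.ι (f ⊗ₜ[ℂ] a)) x = f x • a

/-- The seminorm on `C(X) ⊗ A` that is transported from `C(X, A)` along `π`. -/
def tensorSeminorm (τ : StateSpace A) (I : ℕ → StarSubalgebra ℂ A) (β : ℕ → ℝ)
    (T : CStarTensor.{u, v, w} C(X, ℂ) A) (π : T.carrier ≃⋆ₐ[ℂ] C(X, A)) (t : T.carrier) : ℝ≥0∞ :=
  ahSeminorm τ I β (π t)

/-- The pair `(C(X) ⊗ A, L)`. -/
def tensorPair (τ : StateSpace A) (I : ℕ → StarSubalgebra ℂ A) (β : ℕ → ℝ)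
    (T : CStarTensor.{u, v, w} C(X, ℂ) A) (π : T.carrier ≃⋆ₐ[ℂ] C(X, A)) : QPair.{w} :=
  QPair.of T.carrier (tensorSeminorm τ I β T π)

/-- The pair `(C(X) ⊗ B, L)`, where `L` is restricted to `C(X) ⊗ B ⊆ C(X) ⊗ A`. -/
def tensorSubPair (τ : StateSpace A) (I : ℕ → StarSubalgebra ℂ A) (β : ℕ → ℝ)
    (T : CStarTensor.{u, v, w} C(X, ℂ) A) (π : T.carrier ≃⋆ₐ[ℂ] C(X, A))
    (B : StarSubalgebra ℂ A) : QPair.{w} :=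
  QPair.of (T.sub B) (fun t => tensorSeminorm τ I β T π (t : T.carrier))

end Tensor

end

/-! Exchanging two suprema turns the seminorm into `L(f) = l(f) + sup_x L^β(f(x))`, so
subadditivity, semicontinuity and the product estimate are checked separately for the Lipschitz
seminorm on `X` and for `L^β` on `A`. The map `E_n` is the orthogonal projection onto `A_n` for the
inner product `τ(b* a)`: faithfulness makes it unique, the trace property makes it contractive in
the C*-norm, and `E_k E_n = E_n E_k = E_k` for `k ≤ n`. The quasi-Leibniz constant 2 is the norm
bound of `id - E_n`, applied to `ab - E_n(a) E_n(b)`.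

For the metric property it suffices that the elements of the unit ball of `L` that vanish on one
fixed state form a totally bounded set (`exists_metricSpace_mkDist`). With the state `τ ∘ ev_{x₀}`
this holds by `totallyBounded_ahSeminorm_ball`: the set is bounded because `β(0)` controls the
distance of `f(x)` to the scalars and `l(f)` controls the variation of `τ ∘ f`. Moreover `f` is
uniformly close to `∑ ψ_i ⊗ E_n(f(x_i))` for a partition of unity that depends only on the
precision, with coefficients in a ball of a finite-dimensional space. Similar sums, with Lipschitz
`ψ_i` and coefficients in some `A_m`, show that the domain is dense.

The propinquity bound uses a single bridge with pivot 1 (`propinquity_le_of_isModel`). Its height is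
zero because states extend along injective *-homomorphisms; its reach is at most `β(n)` because
`E_n^X` does not increase `L` and moves the unit ball of `L` by at most `β(n)`.

For the tensor product, `C(X) ⊗ B` is already all of the C*-algebra `C(X, B)` when `B` is
finite-dimensional, and injective *-homomorphisms of C*-algebras are isometric. Hence all C*-norms
agree on `C(X) ⊗ A_n` and, by approximation, on `C(X) ⊗ A` (`norm_eq_norm_tensorToCont`). The
predicate `IsModel` lets one argument serve `C(X, A)`, `C(X, A_n)` and their tensor counterparts. -/

/-! ### States -/

section States

variable {A : Type u} [CStarAlgebra A]

/-- A state as a positive linear map. -/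
noncomputable def IsState.toPositive [PartialOrder A] [StarOrderedRing A] {φ : WeakDual ℂ A}
    (hφ : IsState φ) : A →ₚ[ℂ] ℂ :=
  .mk₀ (WeakDual.toStrongDual φ).toLinearMap fun x hx => by
    obtain ⟨b, rfl⟩ := CStarAlgebra.nonneg_iff_eq_star_mul_self.mp hx
    exact hφ.2 b

@[simp]
lemma IsState.toPositive_apply [PartialOrder A] [StarOrderedRing A] {φ : WeakDual ℂ A}
    (hφ : IsState φ) (a : A) : hφ.toPositive a = φ a := rfl

lemma IsState.map_star {φ : WeakDual ℂ A} (hφ : IsState φ) (a : A) :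
    φ (star a) = star (φ a) := by
  let _ := CStarAlgebra.spectralOrder A
  have _ := CStarAlgebra.spectralOrderedRing A
  exact StarHomClass.map_star hφ.toPositive a

/-- This is Cauchy-Schwarz for the GNS inner product of the state. -/
lemma IsState.cauchy_schwarz {φ : WeakDual ℂ A} (hφ : IsState φ) (a b : A) :
    ‖φ (star a * b)‖ ^ 2 ≤ (φ (star a * a)).re * (φ (star b * b)).re := by
  let _ := CStarAlgebra.spectralOrder A
  have _ := CStarAlgebra.spectralOrderedRing A
  let f := hφ.toPositive
  have h := norm_inner_le_norm (𝕜 := ℂ) (f.toPreGNS a) (f.toPreGNS b)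
  have hn : ∀ c : A, ‖f.toPreGNS c‖ ^ 2 = (φ (star c * c)).re := fun c => by
    have := f.preGNS_norm_sq (f.toPreGNS c)
    have := congrArg Complex.re this
    rw [← Complex.ofReal_pow, Complex.ofReal_re] at this
    simpa [f] using this
  calc ‖φ (star a * b)‖ ^ 2 = ‖inner ℂ (f.toPreGNS a) (f.toPreGNS b)‖ ^ 2 := by
        rw [f.preGNS_inner_def]; rfl
    _ ≤ (‖f.toPreGNS a‖ * ‖f.toPreGNS b‖) ^ 2 := by gcongr
    _ = _ := by rw [mul_pow, hn, hn]

/-- Conjugate `a* a ≤ ‖a‖²` by `c` and apply the state: left multiplication by `a` is bounded by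
`‖a‖` in the GNS seminorm. -/
lemma IsState.apply_star_mul_mul_le {φ : WeakDual ℂ A} (hφ : IsState φ) (a c : A) :
    (φ (star (a * c) * (a * c))).re ≤ ‖a‖ ^ 2 * (φ (star c * c)).re := by
  let _ := CStarAlgebra.spectralOrder A
  have _ := CStarAlgebra.spectralOrderedRing A
  have h := star_left_conjugate_le_conjugate
    (CStarAlgebra.star_mul_le_algebraMap_norm_sq (a := a)) c
  have h2 := OrderHomClass.mono hφ.toPositive h
  have h3 := (Complex.le_def.mp h2).1
  have e : star c * algebraMap ℝ A (‖a‖ ^ 2) * c = ((‖a‖ ^ 2 : ℝ) : ℂ) • (star c * c) := by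
    rw [Algebra.algebraMap_eq_smul_one]
    simp [← Complex.coe_smul]
  rw [e] at h3
  simp only [IsState.toPositive_apply, map_smul, smul_eq_mul, Complex.re_ofReal_mul] at h3
  rw [star_mul]
  simpa only [mul_assoc] using h3

lemma IsState.norm_apply_le {φ : WeakDual ℂ A} (hφ : IsState φ) (a : A) : ‖φ a‖ ≤ ‖a‖ := by
  have h := hφ.cauchy_schwarz 1 a
  have h2 := hφ.apply_star_mul_mul_le a 1
  simp only [star_one, one_mul, mul_one, hφ.1, Complex.one_re] at h h2
  exact le_of_sq_le_sq (h.trans h2) (norm_nonneg _)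

/-- By the C*-identity the left side is `‖h² + t²‖`. The growth by only `t²` forces contractive
unital functionals to be real on self-adjoint elements. -/
lemma norm_add_I_smul_sq_le (h : A) (hh : IsSelfAdjoint h) (t : ℝ) :
    ‖h + (t * Complex.I : ℂ) • (1 : A)‖ ^ 2 ≤ ‖h‖ ^ 2 + t ^ 2 := by
  rcases subsingleton_or_nontrivial A with hA | hA
  · rw [Subsingleton.elim (h + _) 0, norm_zero]
    nlinarith [sq_nonneg ‖h‖, sq_nonneg t]
  rw [sq, ← CStarRing.norm_star_mul_self]
  have : star (h + (t * Complex.I : ℂ) • (1 : A)) * (h + (t * Complex.I : ℂ) • (1 : A))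
      = h * h + ((t ^ 2 : ℝ) : ℂ) • (1 : A) := by
    simp only [star_add, hh.star_eq, star_smul, star_one, add_mul, mul_add, smul_mul_assoc,
      mul_smul_comm, one_mul, mul_one]
    simp only [RCLike.star_def, map_mul, Complex.conj_I, Complex.conj_ofReal]
    have e : (t * Complex.I * (t * -Complex.I) : ℂ) = ((t ^ 2 : ℝ) : ℂ) := by
      push_cast
      linear_combination (-(t : ℂ) ^ 2) * Complex.I_mul_I
    rw [smul_add, smul_smul, e, mul_neg, neg_smul]
    abel
  rw [this]
  refine (norm_add_le _ _).trans (add_le_add ?_ ?_)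
  · rw [sq]; exact norm_mul_le _ _
  · rw [norm_smul, norm_one, mul_one, Complex.norm_real, Real.norm_of_nonneg (by positivity)]

/-- Positivity follows from contractivity, so norm-preserving extensions of states are again states.
-/
lemma isState_of_norm_le {φ : WeakDual ℂ A} (h1 : φ 1 = 1) (h : ∀ a, ‖φ a‖ ≤ ‖a‖) :
    IsState φ := by
  have hreal : ∀ a : A, IsSelfAdjoint a → (φ a).im = 0 := by
    intro a ha
    have key : ∀ t : ℝ, 2 * (t * (φ a).im) ≤ ‖a‖ ^ 2 := by
      intro t
      have h2 := h (a + (t * Complex.I : ℂ) • (1 : A))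
      have h3 := pow_le_pow_left₀ (norm_nonneg _) h2 2
      have h4 := h3.trans (norm_add_I_smul_sq_le a ha t)
      rw [map_add, map_smul, h1, smul_eq_mul, mul_one, Complex.sq_norm, Complex.normSq_apply] at h4
      simp only [Complex.add_re, Complex.add_im, Complex.mul_re, Complex.mul_im, Complex.ofReal_re,
        Complex.ofReal_im, Complex.I_re, Complex.I_im] at h4
      nlinarith [sq_nonneg (φ a).re, sq_nonneg (φ a).im]
    by_contra hne
    -- This `t` makes the left side of `key` equal to `2 (‖a‖² + 1)`, which exceeds `‖a‖²`.
    have := key ((‖a‖ ^ 2 + 1) / (φ a).im)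
    rw [div_mul_cancel₀ _ hne] at this
    nlinarith [sq_nonneg ‖a‖]
  refine ⟨h1, fun b => ?_⟩
  let _ := CStarAlgebra.spectralOrder A
  have _ := CStarAlgebra.spectralOrderedRing A
  rw [Complex.le_def]
  refine ⟨?_, (hreal _ (.star_mul_self b)).symm⟩
  set a := star b * b
  have ha : 0 ≤ a := star_mul_self_nonneg b
  set r : ℝ := ‖a‖
  -- For `0 ≤ a` and `r = ‖a‖` one has `0 ≤ r - a ≤ r`; contractivity then yields `r - Re φ(a) ≤ r`.
  have hc : ‖algebraMap ℝ A r - a‖ ≤ r := by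
    refine (CStarAlgebra.norm_le_iff_le_algebraMap _ (norm_nonneg _) ?_).mpr ?_
    · exact sub_nonneg.mpr (IsSelfAdjoint.le_algebraMap_norm_self (.of_nonneg ha))
    · exact sub_le_self _ ha
  have h2 := h (algebraMap ℝ A r - a)
  have e : φ (algebraMap ℝ A r) = (r : ℂ) := by
    rw [Algebra.algebraMap_eq_smul_one, ← Complex.coe_smul, map_smul, h1]; simp
  rw [map_sub, e] at h2
  have h3 := (Complex.re_le_norm ((r : ℂ) - φ a)).trans (h2.trans hc)
  simp only [Complex.sub_re, Complex.ofReal_re] at h3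
  simpa using h3

/-- A state extends along an injective *-homomorphism. -/
lemma IsState.exists_extension {D : Type v} [CStarAlgebra D] (ρ : A →⋆ₐ[ℂ] D)
    (hρ : Function.Injective ρ) (ψ : StateSpace A) :
    ∃ φ : StateSpace D, ∀ a, φ.1 (ρ a) = ψ.1 a := by
  let e : A ≃ₗ[ℂ] LinearMap.range ρ.toAlgHom.toLinearMap :=
    LinearEquiv.ofInjective ρ.toAlgHom.toLinearMap hρ
  have he : ∀ a : A, ((e a : LinearMap.range ρ.toAlgHom.toLinearMap) : D) = ρ a := fun a => rfl
  let g : LinearMap.range ρ.toAlgHom.toLinearMap →ₗ[ℂ] ℂ :=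
    (WeakDual.toStrongDual ψ.1).toLinearMap.comp e.symm.toLinearMap
  have hg : ∀ x, ‖g x‖ ≤ 1 * ‖x‖ := by
    intro x
    obtain ⟨a, rfl⟩ := e.surjective x
    rw [one_mul, Submodule.coe_norm, he, NonUnitalStarAlgHom.norm_map ρ hρ]
    simpa [g] using ψ.2.norm_apply_le a
  -- Hahn-Banach extends from the range of `ρ` without increasing the norm; the result is
  -- contractive and unital, hence a state.
  obtain ⟨φ, h1, h2⟩ := exists_extension_norm_eq _ (g.mkContinuous 1 hg)
  have hφ : ∀ a, φ (ρ a) = ψ.1 a := fun a => by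
    rw [← he, h1]; simp [g]
  refine ⟨⟨StrongDual.toWeakDual φ, isState_of_norm_le ?_ fun a => ?_⟩, hφ⟩
  · have := hφ 1
    rw [map_one, ψ.2.1] at this
    exact this
  · refine (φ.le_opNorm a).trans ?_
    rw [h2]
    calc _ ≤ 1 * ‖a‖ := by gcongr; exact LinearMap.mkContinuous_norm_le _ zero_le_one hg
      _ = _ := one_mul _

end States

/-! ### Finite-dimensional C*-algebras -/

section FiniteDimensional

variable {B : Type u} [CStarAlgebra B]

/-- The spectrum consists of roots of the minimal polynomial. -/
lemma finite_spectrum_real [FiniteDimensional ℂ B] (b : B) : (spectrum ℝ b).Finite := by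
  have : FiniteDimensional ℝ B := FiniteDimensional.complexToReal B
  have hint : IsIntegral ℝ b := Algebra.IsIntegral.isIntegral b
  refine ((minpoly ℝ b).rootSet_finite ℝ).subset fun x hx => ?_
  have h := spectrum.subset_polynomial_aeval b (minpoly ℝ b) ⟨x, hx, rfl⟩
  rw [minpoly.aeval] at h
  have : Nontrivial B := by
    by_contra hB
    rw [not_nontrivial_iff_subsingleton] at hB
    simp [spectrum.of_subsingleton] at hx
  rw [spectrum.zero_eq, Set.mem_singleton_iff] at h
  rw [Polynomial.mem_rootSet]
  exact ⟨minpoly.ne_zero hint, by simpa using h⟩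

/-- A finite-dimensional C*-algebra is spanned by its projections. -/
lemma span_isStarProjection_eq_top [FiniteDimensional ℂ B] :
    Submodule.span ℂ {p : B | IsStarProjection p} = ⊤ := by
  rw [eq_top_iff, ← span_selfAdjoint, Submodule.span_le]
  intro b hb
  have hb : IsSelfAdjoint b := hb
  have hfin := finite_spectrum_real b
  have hc : ∀ f : ℝ → ℝ, ContinuousOn f (spectrum ℝ b) := fun f => hfin.continuousOn f
  -- Indicators of points are continuous on the finite spectrum, so the functional calculus yields
  -- spectral projections `p_l` with `b = ∑ l p_l`.
  let g : ℝ → ℝ → ℝ := fun l t => if t = l then 1 else 0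
  have hproj : ∀ l, IsStarProjection (cfc (g l) b) := by
    intro l
    refine ⟨?_, cfc_predicate _ _⟩
    rw [IsIdempotentElem, ← cfc_mul _ _ _ (hc _) (hc _)]
    congr 1
    ext t
    simp [g]
  have hsum : b = ∑ l ∈ hfin.toFinset, (l : ℂ) • cfc (g l) b := by
    have h1 : ∀ l ∈ hfin.toFinset, (l : ℂ) • cfc (g l) b = cfc (fun t => l • g l t) b := by
      intro l _
      rw [cfc_smul _ _ _ (hc _), Complex.coe_smul]
    rw [Finset.sum_congr rfl h1, ← cfc_sum _ _ _ (fun i _ => hc _)]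
    conv_lhs => rw [← cfc_id ℝ b]
    refine cfc_congr fun t ht => ?_
    simp [g, ht]
  rw [hsum]
  exact Submodule.sum_mem _ fun l _ => Submodule.smul_mem _ _ (Submodule.subset_span (hproj l))

/-- If left multiplication by `y` is bounded by `K` in the `L²`-norm of a faithful state, then the
norm of `y` is at most `K`. -/
lemma norm_le_of_apply_le {σ : WeakDual ℂ B} (hσ : IsState σ)
    (hf : ∀ a : B, σ (star a * a) = 0 → a = 0) {y : B} {K : ℝ} (hK : 0 ≤ K)
    (h : ∀ c : B, (σ (star (y * c) * (y * c))).re ≤ K ^ 2 * (σ (star c * c)).re) :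
    ‖y‖ ≤ K := by
  let _ := CStarAlgebra.spectralOrder B
  have _ := CStarAlgebra.spectralOrderedRing B
  set x := star y * y with hx
  have hx0 : 0 ≤ x := star_mul_self_nonneg y
  have hxs : IsSelfAdjoint x := .of_nonneg hx0
  -- The test vector is `c = (x - K²)₊`. The hypothesis at `c` makes `σ` nonpositive on `c (x - K²)
  -- c`, which is a positive element. Faithfulness makes it zero, so the spectrum of `x = y* y` does
  -- not exceed `K²`.
  let m : ℝ → ℝ := fun t => max (t - K ^ 2) 0
  have hm : Continuous m := by fun_prop
  set c := cfc m x with hc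
  have hcs : IsSelfAdjoint c := cfc_predicate _ _
  let e : ℝ → ℝ := fun t => m t * (t - K ^ 2) * m t
  have he : Continuous e := by fun_prop
  have hcube : star c * (x - algebraMap ℝ B (K ^ 2)) * c = cfc e x := by
    have : x - algebraMap ℝ B (K ^ 2) = cfc (fun t : ℝ => t - K ^ 2) x := by
      rw [cfc_sub _ _ x (by fun_prop) (by fun_prop), cfc_id' ℝ x, cfc_const _ x]
    rw [hcs.star_eq, this, hc, ← cfc_mul _ _ _ (by fun_prop) (by fun_prop),
      ← cfc_mul _ _ _ (by fun_prop) (by fun_prop)]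
  have hepos : ∀ t, 0 ≤ e t := by
    intro t
    simp only [e, m]
    rcases le_total (t - K ^ 2) 0 with h0 | h0
    · simp [max_eq_right h0]
    · rw [max_eq_left h0]; positivity
  have hpos : 0 ≤ cfc e x := cfc_nonneg fun t _ => hepos t
  obtain ⟨d, hd⟩ := CStarAlgebra.nonneg_iff_eq_star_mul_self.mp hpos
  have hle : (σ (cfc e x)).re ≤ 0 := by
    have h1 := h c
    rw [← hcube, mul_sub, sub_mul, map_sub, Complex.sub_re]
    have e1 : star c * algebraMap ℝ B (K ^ 2) * c = ((K ^ 2 : ℝ) : ℂ) • (star c * c) := by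
      rw [Algebra.algebraMap_eq_smul_one]
      simp [← Complex.coe_smul]
    have e2 : star (y * c) * (y * c) = star c * x * c := by
      rw [hx, star_mul]; simp only [mul_assoc]
    rw [e1, map_smul, smul_eq_mul, Complex.re_ofReal_mul, ← e2]
    linarith
  have hz : σ (star d * d) = 0 := by
    have := hσ.2 d
    rw [hd] at hle
    rw [Complex.le_def] at this
    exact Complex.ext (le_antisymm hle this.1) this.2.symm
  have hz2 : cfc e x = cfc (fun _ => 0 : ℝ → ℝ) x := by
    rw [hd, hf d hz]; simp
  rw [cfc_eq_cfc_iff_eqOn (ha := hxs) (hf := he.continuousOn) (hg := continuousOn_const)] at hz2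
  have hspec : x ≤ algebraMap ℝ B (K ^ 2) := by
    rw [le_algebraMap_iff_spectrum_le]
    intro t ht
    have := hz2 ht
    by_contra! hlt
    simp only [e, m] at this
    rw [max_eq_left (by linarith)] at this
    have h3 : 0 < (t - K ^ 2) := by linarith
    have : 0 < (t - K ^ 2) * (t - K ^ 2) * (t - K ^ 2) := by positivity
    linarith
  have hn := (CStarAlgebra.norm_le_iff_le_algebraMap x (sq_nonneg K) hx0).mpr hspec
  rw [hx, CStarRing.norm_star_mul_self, ← sq] at hn
  exact le_of_sq_le_sq hn hK

end FiniteDimensional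

/-! ### Conditional expectations onto finite-dimensional subalgebras -/

section CondExpectation

variable {A : Type v} [CStarAlgebra A]

lemma IsStarProjection.norm_le_one' {p : A} (hp : IsStarProjection p) : ‖p‖ ≤ 1 := by
  have h : ‖p‖ * ‖p‖ = ‖p‖ := by
    rw [← CStarRing.norm_star_mul_self, hp.isSelfAdjoint.star_eq, hp.isIdempotentElem.eq]
  nlinarith [norm_nonneg p]

/-- If `p` is a projection then `‖p x + (1 - p) y‖² ≤ ‖p x‖² + ‖(1 - p) y‖²`. -/
lemma IsStarProjection.norm_add_sq_le {p : A} (hp : IsStarProjection p) (x y : A) :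
    ‖p * x + (1 - p) * y‖ ^ 2 ≤ ‖p * x‖ ^ 2 + ‖(1 - p) * y‖ ^ 2 := by
  have hp' : p * p = p := hp.isIdempotentElem.eq
  have h : star (p * x + (1 - p) * y) * (p * x + (1 - p) * y) =
      star (p * x) * (p * x) + star ((1 - p) * y) * ((1 - p) * y) := by
    have e1 : star (p * x) * ((1 - p) * y) = 0 := by
      rw [star_mul, hp.isSelfAdjoint.star_eq, mul_assoc, ← mul_assoc p, mul_sub, mul_one, hp',
        sub_self, zero_mul, mul_zero]
    have e2 : star ((1 - p) * y) * (p * x) = 0 := by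
      rw [← star_star (star ((1 - p) * y) * (p * x)), star_mul, star_star, e1, star_zero]
    rw [star_add, add_mul, mul_add, mul_add, e1, e2, add_zero, zero_add]
  rw [sq, ← CStarRing.norm_star_mul_self, h, sq, sq, ← CStarRing.norm_star_mul_self,
    ← CStarRing.norm_star_mul_self (x := (1 - p) * y)]
  exact norm_add_le _ _

variable {B : StarSubalgebra ℂ A} {E : A →L[ℂ] B}

/-- Tomiyama's perturbation trick. Let `q = (1 - p) E(px)`, an element of `B` that `E` fixes. Adding
`t q` to `px` scales the compressed image to `(1 + t) q`, while the squared norm of the argument is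
at most `‖px‖² + t² ‖q‖²`. The quadratic terms cancel and the linear term in `t` forces `q = 0`. -/
lemma IsCondExp.one_sub_mul_apply (hE : IsCondExp B E) {p : B} (hp : IsStarProjection (p : A))
    (x : A) : (1 - (p : A)) * (E (p * x) : A) = 0 := by
  set q : B := (1 - p) * E (p * x) with hq
  have hqA : (q : A) = (1 - (p : A)) * (E (p * x) : A) := by simp [hq]
  have hpp : (p : A) * p = p := hp.isIdempotentElem.eq
  have hq2 : (1 - (p : A)) * q = q := by
    rw [hqA, ← mul_assoc, hp.isIdempotentElem.one_sub.eq]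
  have key : ∀ t : ℝ, (1 + 2 * t) * ‖(q : A)‖ ^ 2 ≤ ‖(p : A) * x‖ ^ 2 := by
    intro t
    have e1 : (1 - (p : A)) * (E (p * x + (t : ℂ) • (q : A)) : A) = ((1 + t : ℝ) : ℂ) • (q : A) := by
      rw [map_add, map_smul, hE.proj]
      push_cast
      rw [mul_add, ← hqA, mul_smul_comm, hq2, add_smul, one_smul]
    have h1 : (1 + t) ^ 2 * ‖(q : A)‖ ^ 2 ≤ ‖(p : A) * x + (t : ℂ) • (q : A)‖ ^ 2 := by
      calc (1 + t) ^ 2 * ‖(q : A)‖ ^ 2 = ‖((1 + t : ℝ) : ℂ) • (q : A)‖ ^ 2 := by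
            rw [norm_smul, Complex.norm_real, mul_pow, Real.norm_eq_abs, sq_abs]
        _ = ‖(1 - (p : A)) * (E (p * x + (t : ℂ) • (q : A)) : A)‖ ^ 2 := by rw [e1]
        _ ≤ (‖1 - (p : A)‖ * ‖(E (p * x + (t : ℂ) • (q : A)) : A)‖) ^ 2 := by
            gcongr; exact norm_mul_le _ _
        _ ≤ (1 * ‖(p : A) * x + (t : ℂ) • (q : A)‖) ^ 2 := by
            gcongr
            · exact hp.one_sub.norm_le_one'
            · exact hE.contractive _
        _ = _ := by rw [one_mul]
    have h2 := hp.norm_add_sq_le x ((t : ℂ) • (q : A))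
    rw [mul_smul_comm, hq2, norm_smul (t : ℂ), Complex.norm_real, mul_pow, Real.norm_eq_abs,
      sq_abs] at h2
    nlinarith
  rw [← hqA]
  by_contra hne
  have hpos : 0 < ‖(q : A)‖ ^ 2 := by positivity
  -- With this `t`, `key` reads `‖q‖² + 2 ‖px‖² ≤ ‖px‖²`.
  have := key (‖(p : A) * x‖ ^ 2 / ‖(q : A)‖ ^ 2)
  have e : ‖(p : A) * x‖ ^ 2 / ‖(q : A)‖ ^ 2 * ‖(q : A)‖ ^ 2 = ‖(p : A) * x‖ ^ 2 :=
    div_mul_cancel₀ _ hpos.ne'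
  nlinarith [sq_nonneg ‖(p : A) * x‖]

/-- The preceding lemma for `p` gives `E(px) = p E(px)`, and for `1 - p` it gives `p E((1 - p)x) =
0`; add the two. -/
lemma IsCondExp.map_isStarProjection_mul (hE : IsCondExp B E) {p : B}
    (hp : IsStarProjection (p : A)) (x : A) : E (p * x) = p * E x := by
  have h1 := hE.one_sub_mul_apply hp x
  have hp' : IsStarProjection ((1 - p : B) : A) := by simpa using hp.one_sub
  have h2 := hE.one_sub_mul_apply hp' x
  apply Subtype.ext
  have hx : x = p * x + ((1 - p : B) : A) * x := by simp [sub_mul]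
  rw [sub_mul, one_mul, sub_eq_zero] at h1
  simp only [AddSubgroupClass.coe_sub, OneMemClass.coe_one, sub_sub_cancel] at h2
  conv_rhs => rw [hx]
  simp only [map_add, MulMemClass.coe_mul, AddMemClass.coe_add, mul_add, AddSubgroupClass.coe_sub,
    OneMemClass.coe_one]
  rw [← h1, h2, add_zero]

/-- Tomiyama's theorem: a conditional expectation is a module map. -/
lemma IsCondExp.map_mul [FiniteDimensional ℂ B] (hE : IsCondExp B E) (b : B) (x : A) :
    E (b * x) = b * E x := by
  have hb : b ∈ Submodule.span ℂ {p : B | IsStarProjection p} := by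
    rw [span_isStarProjection_eq_top]; trivial
  induction hb using Submodule.span_induction with
  | mem p hp =>
    refine hE.map_isStarProjection_mul ⟨?_, ?_⟩ x
    · exact congrArg Subtype.val hp.isIdempotentElem.eq
    · exact congrArg Subtype.val hp.isSelfAdjoint.star_eq
  | zero => simp
  | add b c _ _ hb hc => simp [add_mul, hb, hc]
  | smul r b _ hb => simp [hb]

variable {τ : StateSpace A}

lemma IsPreservingCondExp.apply_mul [FiniteDimensional ℂ B] (hE : IsPreservingCondExp τ B E)
    (b : B) (x : A) : τ.1 (b * (E x : A)) = τ.1 (b * x) := by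
  rw [← hE.2 (b * x), hE.1.map_mul, MulMemClass.coe_mul]

lemma StateSpace.IsFaithful.eq_of_apply_mul_eq (hτ : τ.IsFaithful) {x y : B}
    (h : ∀ b : B, τ.1 (b * (x : A)) = τ.1 (b * (y : A))) : x = y := by
  have h1 := h (star (x - y))
  rw [← sub_eq_zero, ← map_sub, ← mul_sub] at h1
  have := hτ ((x : A) - y) (by simpa using h1)
  exact Subtype.ext (sub_eq_zero.mp this)

/-- By the module property `E a` is the orthogonal projection of `a` onto `B` in the inner product
of `τ`. This characterization yields uniqueness, compatibility with adjoints and the tower property.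
-/
lemma IsPreservingCondExp.eq_iff [FiniteDimensional ℂ B] (hτ : τ.IsFaithful)
    (hE : IsPreservingCondExp τ B E) {a : A} {y : B} :
    E a = y ↔ ∀ b : B, τ.1 (b * (y : A)) = τ.1 (b * a) := by
  constructor
  · rintro rfl b
    exact hE.apply_mul b a
  · intro h
    exact hτ.eq_of_apply_mul_eq fun b => by rw [hE.apply_mul, h]

/-- The restriction of a state to a subalgebra. -/
noncomputable def StateSpace.restrict (τ : StateSpace A) (B : StarSubalgebra ℂ A)
    [IsClosed (B : Set A)] : StateSpace B :=
  ⟨StrongDual.toWeakDual ((WeakDual.toStrongDual τ.1).comp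
    ⟨B.subtype.toAlgHom.toLinearMap, continuous_subtype_val⟩), τ.2.1, fun b => τ.2.2 b⟩

/-- The form `τ(b x)` is nondegenerate on the finite-dimensional `B`, so each functional `b ↦ τ(b
a)` is represented by some `F a` in `B`. Contractivity is tested on the GNS space of `B`. -/
lemma exists_isPreservingCondExp [FiniteDimensional ℂ B] (hτ : τ.IsFaithful)
    (hτ' : τ.IsTracial) : ∃ E : A →L[ℂ] B, IsPreservingCondExp τ B E := by
  let t : A →ₗ[ℂ] ℂ := (WeakDual.toStrongDual τ.1).toLinearMap
  let G : A →ₗ[ℂ] Module.Dual ℂ B :=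
    LinearMap.mk₂ ℂ (fun (a : A) (b : B) => t (b * a)) (fun a a' b => by simp [mul_add])
      (fun c a b => by simp) (fun a b b' => by simp [add_mul]) (fun c a b => by simp)
  have hG : ∀ a b, G a b = τ.1 (b * a) := fun a b => rfl
  let T : B →ₗ[ℂ] Module.Dual ℂ B := G.comp B.subtype.toAlgHom.toLinearMap
  have hT : ∀ x b, T x b = τ.1 (b * (x : A)) := fun a b => rfl
  have hinj : Function.Injective T := fun x y hxy =>
    hτ.eq_of_apply_mul_eq fun b => by rw [← hT, ← hT, hxy]
  have hsurj : Function.Surjective T :=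
    (LinearMap.injective_iff_surjective_of_finrank_eq_finrank Subspace.dual_finrank_eq.symm).mp hinj
  let e := LinearEquiv.ofBijective T ⟨hinj, hsurj⟩
  let F : A →ₗ[ℂ] B := e.symm.toLinearMap.comp G
  have hF : ∀ (a : A) (b : B), τ.1 (b * (F a : A)) = τ.1 (b * a) := by
    intro a b
    have h : T (F a) = G a := e.apply_symm_apply (G a)
    rw [← hT, h, hG]
  have hcontr : ∀ a, ‖F a‖ ≤ ‖a‖ := by
    intro a
    refine norm_le_of_apply_le (τ.restrict B).2 (fun b hb => Subtype.ext (hτ _ hb))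
      (norm_nonneg a) fun c => ?_
    change (τ.1 (star ((F a : A) * c) * ((F a : A) * c))).re ≤
      ‖a‖ ^ 2 * (τ.1 (star (c : A) * c)).re
    set d : A := (F a : A) * c with hd
    -- The defining relation only allows a factor from `B` on the left; the trace property moves `c`
    -- there. Cauchy-Schwarz then gives `τ(d* d)² ≤ τ(d* d) ‖a‖² τ(c* c)`, and one factor `τ(d* d)`
    -- is cancelled.
    have h1 : τ.1 (star d * d) = τ.1 (star d * (a * c)) := by
      have := hF a (c * star (F a * c))
      rw [MulMemClass.coe_mul, mul_assoc, hτ', mul_assoc (c : A), hτ' (c : A)] at this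
      simpa only [mul_assoc, hd, StarMemClass.coe_star, MulMemClass.coe_mul] using this
    have h2 := τ.2.cauchy_schwarz d (a * c)
    have h3 := τ.2.apply_star_mul_mul_le a c
    rw [← h1] at h2
    have h4 := (Complex.le_def.mp (τ.2.2 d)).1
    simp only [Complex.zero_re] at h4
    have h5 := Complex.re_le_norm (τ.1 (star d * d))
    by_cases h0 : (τ.1 (star d * d)).re = 0
    · rw [h0]
      have := (Complex.le_def.mp (τ.2.2 (c : A))).1
      simp only [Complex.zero_re] at this
      positivity
    · have h6 : 0 < (τ.1 (star d * d)).re := lt_of_le_of_ne h4 (Ne.symm h0)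
      nlinarith
  refine ⟨F.mkContinuous 1 fun a => by simpa using hcontr a, ⟨fun b => ?_, hcontr⟩, fun a => ?_⟩
  · exact hτ.eq_of_apply_mul_eq fun c => hF b c
  · simpa using hF a 1

lemma existsUnique_isPreservingCondExp [FiniteDimensional ℂ B] (hτ : τ.IsFaithful)
    (hτ' : τ.IsTracial) : ∃! E : A →L[ℂ] B, IsPreservingCondExp τ B E := by
  obtain ⟨E, hE⟩ := exists_isPreservingCondExp (B := B) hτ hτ'
  refine ⟨E, hE, fun E' hE' => ContinuousLinearMap.ext fun a => ?_⟩
  rw [hE'.eq_iff hτ]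
  exact fun b => hE.apply_mul b a

end CondExpectation

/-! ### Identities and estimates for the chosen conditional expectations -/

section CondExp

variable {A : Type v} [CStarAlgebra A]

lemma condExp_spec (τ : StateSpace A) (B : StarSubalgebra ℂ A) [FiniteDimensional ℂ B]
    (hτ : τ.IsFaithful) (hτ' : τ.IsTracial) : IsPreservingCondExp τ B (condExp τ B) := by
  have h := exists_isPreservingCondExp (B := B) hτ hτ'
  rw [condExp, dif_pos h]
  exact h.choose_spec

lemma condExp_eq_iff (τ : StateSpace A) (B : StarSubalgebra ℂ A) [FiniteDimensional ℂ B]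
    (hτ : τ.IsFaithful) (hτ' : τ.IsTracial) {a : A} {y : B} :
    condExp τ B a = y ↔ ∀ b : B, τ.1 (b * (y : A)) = τ.1 (b * a) :=
  (condExp_spec τ B hτ hτ').eq_iff hτ

lemma condExp_coe (τ : StateSpace A) (B : StarSubalgebra ℂ A) [FiniteDimensional ℂ B]
    (hτ : τ.IsFaithful) (hτ' : τ.IsTracial) (b : B) : condExp τ B b = b := (condExp_spec τ B hτ hτ').1.proj b

lemma condExp_of_mem (τ : StateSpace A) (B : StarSubalgebra ℂ A) [FiniteDimensional ℂ B]
    (hτ : τ.IsFaithful) (hτ' : τ.IsTracial) {a : A} (ha : a ∈ B) : (condExp τ B a : A) = a :=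
  congrArg Subtype.val (condExp_coe τ B hτ hτ' ⟨a, ha⟩)

lemma norm_condExp_apply_le (τ : StateSpace A) (B : StarSubalgebra ℂ A) [FiniteDimensional ℂ B]
    (hτ : τ.IsFaithful) (hτ' : τ.IsTracial) (a : A) : ‖(condExp τ B a : A)‖ ≤ ‖a‖ :=
  (condExp_spec τ B hτ hτ').1.contractive a

lemma condExp_star (τ : StateSpace A) (B : StarSubalgebra ℂ A) [FiniteDimensional ℂ B]
    (hτ : τ.IsFaithful) (hτ' : τ.IsTracial) (a : A) : condExp τ B (star a) = star (condExp τ B a) := by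
  rw [condExp_eq_iff τ B hτ hτ']
  intro b
  have h := (condExp_eq_iff τ B hτ hτ').mp (rfl : condExp τ B a = _) (star b)
  have h2 := congrArg star h
  rw [← τ.2.map_star, ← τ.2.map_star] at h2
  simp only [star_mul, StarMemClass.coe_star, star_star] at h2 ⊢
  rw [hτ', h2, hτ']

lemma condExp_condExp_of_le (τ : StateSpace A) (B : StarSubalgebra ℂ A) [FiniteDimensional ℂ B]
    (hτ : τ.IsFaithful) (hτ' : τ.IsTracial) {C : StarSubalgebra ℂ A} [FiniteDimensional ℂ C] (hBC : B ≤ C)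
    (a : A) : condExp τ B (condExp τ C a : A) = condExp τ B a := by
  rw [condExp_eq_iff τ B hτ hτ']
  intro b
  rw [(condExp_eq_iff τ B hτ hτ').mp (rfl : condExp τ B a = _)]
  exact ((condExp_eq_iff τ C hτ hτ').mp (rfl : condExp τ C a = _) ⟨b, hBC b.2⟩).symm

/-- Since `E` fixes `E(a) E(b)`, the left side is the norm of `(id - E)(ab - E(a) E(b))`. The factor
2 bounds `id - E`; the rest is the product rule with `‖E(a)‖ ≤ ‖a‖`. -/
lemma norm_mul_sub_condExp_le (τ : StateSpace A) (B : StarSubalgebra ℂ A) [FiniteDimensional ℂ B]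
    (hτ : τ.IsFaithful) (hτ' : τ.IsTracial) (a b : A) :
    ‖a * b - (condExp τ B (a * b) : A)‖ ≤
      2 * (‖a - (condExp τ B a : A)‖ * ‖b‖ + ‖b - (condExp τ B b : A)‖ * ‖a‖) := by
  set a' := condExp τ B a
  set b' := condExp τ B b
  have h1 : ‖a * b - (a' * b' : A)‖ ≤ ‖a - a'‖ * ‖b‖ + ‖b - b'‖ * ‖a‖ := by
    have : a * b - (a' * b' : A) = (a - a') * b + a' * (b - b') := by noncomm_ring
    rw [this]
    refine (norm_add_le _ _).trans (add_le_add (norm_mul_le _ _) ?_)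
    rw [mul_comm]
    exact (norm_mul_le _ _).trans (by gcongr; exact norm_condExp_apply_le τ B hτ hτ' a)
  have h2 : a * b - (condExp τ B (a * b) : A) =
      (a * b - (a' * b' : A)) - (condExp τ B (a * b - (a' * b' : A)) : A) := by
    rw [map_sub, AddSubgroupClass.coe_sub, condExp_of_mem τ B hτ hτ' (mul_mem a'.2 b'.2)]
    abel
  rw [h2]
  refine (norm_sub_le _ _).trans ?_
  have := norm_condExp_apply_le τ B hτ hτ' (a * b - (a' * b' : A))
  linarith

lemma condExp_eq_of_eq_bot (τ : StateSpace A) (B : StarSubalgebra ℂ A) [FiniteDimensional ℂ B]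
    (hτ : τ.IsFaithful) (hτ' : τ.IsTracial) (hB : B = ⊥) (a : A) : (condExp τ B a : A) = τ.1 a • (1 : A) := by
  have h1 : τ.1 a • (1 : A) ∈ B := B.smul_mem B.one_mem _
  have : condExp τ B a = ⟨_, h1⟩ := by
    rw [condExp_eq_iff τ B hτ hτ']
    rintro ⟨b, hb⟩
    subst hB
    obtain ⟨c, rfl⟩ := StarSubalgebra.mem_bot.mp hb
    simp [Algebra.algebraMap_eq_smul_one, τ.2.1, mul_comm]
  rw [this]

end CondExp

/-! ### A criterion for Lip-norms -/

section LipNormCriterion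

variable {A : Type u} [CStarAlgebra A] {L : selfAdjoint A → ℝ≥0∞}

lemma StateSpace.norm_sub_apply_le (φ ψ : StateSpace A) (a : A) :
    ‖φ.1 a - ψ.1 a‖ ≤ 2 * ‖a‖ := by
  refine (norm_sub_le _ _).trans ?_
  have h1 := φ.2.norm_apply_le a
  have h2 := ψ.2.norm_apply_le a
  linarith

lemma StateSpace.ext_selfAdjoint {φ ψ : StateSpace A} (h : ∀ a : selfAdjoint A, φ.1 a = ψ.1 a) :
    φ = ψ := by
  refine Subtype.ext (DFunLike.ext _ _ fun a => ?_)
  rw [← realPart_add_I_smul_imaginaryPart a, map_add, map_add, map_smul, map_smul, h, h]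

lemma StateSpace.apply_selfAdjoint (φ : StateSpace A) (a : selfAdjoint A) :
    φ.1 (a : A) = ((φ.1 (a : A)).re : ℂ) := by
  have h := φ.2.map_star (a : A)
  rw [selfAdjoint.star_val_eq] at h
  exact (Complex.conj_eq_iff_re.mp h.symm).symm

lemma mkDist_self (φ : StateSpace A) : mkDist L φ φ = 0 := by simp [mkDist]

lemma mkDist_comm (φ ψ : StateSpace A) : mkDist L φ ψ = mkDist L ψ φ := by
  simp only [mkDist, enorm_sub_rev]

lemma mkDist_triangle (φ ψ χ : StateSpace A) :
    mkDist L φ χ ≤ mkDist L φ ψ + mkDist L ψ χ := by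
  refine iSup₂_le fun a ha => ?_
  calc ‖φ.1 (a : A) - χ.1 (a : A)‖ₑ
      = ‖(φ.1 (a : A) - ψ.1 (a : A)) + (ψ.1 (a : A) - χ.1 (a : A))‖ₑ := by congr 1; ring
    _ ≤ _ := enorm_add_le _ _
    _ ≤ _ := add_le_add (le_iSup₂ (f := fun (a : selfAdjoint A) (_ : L a ≤ 1) => ‖φ.1 (a : A) - ψ.1 (a : A)‖ₑ) a ha)
      (le_iSup₂ (f := fun (a : selfAdjoint A) (_ : L a ≤ 1) => ‖ψ.1 (a : A) - χ.1 (a : A)‖ₑ) a ha)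

/-- An element `b` of the domain within `ε/2` of `a` changes the difference of two states by at most
`ε`, and `b` itself is controlled by a multiple of the metric. -/
lemma exists_enorm_sub_apply_le_mkDist
    (smul_eq : ∀ (r : ℝ) (a), L (r • a) = ENNReal.ofReal |r| * L a)
    (dense_dom : Dense {a | L a < ∞}) (a : selfAdjoint A) {ε : ℝ} (hε : 0 < ε) :
    ∃ C : ℝ≥0, ∀ φ ψ : StateSpace A,
      ‖φ.1 (a : A) - ψ.1 (a : A)‖ₑ ≤ ENNReal.ofReal ε + C * mkDist L φ ψ := by
  obtain ⟨b, hab, hb⟩ := (Metric.dense_iff.mp dense_dom) a (ε / 2) (half_pos hε)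
  have hb : L b < ∞ := hb
  -- The added 1 keeps the scaling factor positive when `L b = 0`.
  set c : ℝ := (L b).toReal + 1 with hc
  have hc0 : 0 < c := by positivity
  refine ⟨c.toNNReal, fun φ ψ => ?_⟩
  have h1 : L (c⁻¹ • b) ≤ 1 := by
    rw [smul_eq, abs_of_pos (by positivity), ENNReal.ofReal_inv_of_pos hc0,
      ENNReal.inv_mul_le_iff (by simpa using hc0) ENNReal.ofReal_ne_top, mul_one]
    refine ENNReal.le_ofReal_iff_toReal_le hb.ne hc0.le |>.mpr ?_
    rw [hc]; linarith
  have h2 : ‖φ.1 ((c⁻¹ • b : selfAdjoint A) : A) - ψ.1 ((c⁻¹ • b : selfAdjoint A) : A)‖ₑ ≤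
      mkDist L φ ψ :=
    le_iSup₂ (f := fun (a : selfAdjoint A) (_ : L a ≤ 1) => ‖φ.1 (a : A) - ψ.1 (a : A)‖ₑ) _ h1
  have h3 : φ.1 (b : A) - ψ.1 (b : A) = (c : ℂ) •
      (φ.1 ((c⁻¹ • b : selfAdjoint A) : A) - ψ.1 ((c⁻¹ • b : selfAdjoint A) : A)) := by
    have : (b : A) = (c : ℂ) • ((c⁻¹ • b : selfAdjoint A) : A) := by
      rw [selfAdjoint.val_smul, Complex.coe_smul, smul_smul, mul_inv_cancel₀ hc0.ne', one_smul]
    rw [smul_sub, ← map_smul, ← map_smul, ← this]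
  have h4 : φ.1 (a : A) - ψ.1 (a : A) = (φ.1 ((a : A) - b) - ψ.1 ((a : A) - b)) +
      (φ.1 (b : A) - ψ.1 (b : A)) := by
    rw [map_sub, map_sub]; ring
  rw [h4]
  refine (enorm_add_le _ _).trans (add_le_add ?_ ?_)
  · rw [← ofReal_norm]
    refine ENNReal.ofReal_le_ofReal ((φ.norm_sub_apply_le ψ _).trans ?_)
    have : ‖(a : A) - b‖ < ε / 2 := by
      rw [← dist_eq_norm, dist_comm]; exact hab
    linarith
  · rw [h3, enorm_smul]
    refine mul_le_mul' (le_of_eq ?_) h2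
    rw [← ofReal_norm, Complex.norm_real, Real.norm_of_nonneg hc0.le]
    rfl

lemma eq_of_mkDist_eq_zero
    (smul_eq : ∀ (r : ℝ) (a), L (r • a) = ENNReal.ofReal |r| * L a)
    (dense_dom : Dense {a | L a < ∞}) {φ ψ : StateSpace A} (h : mkDist L φ ψ = 0) : φ = ψ := by
  refine StateSpace.ext_selfAdjoint fun a => ?_
  rw [← sub_eq_zero, ← norm_le_zero_iff]
  refine le_of_forall_pos_le_add fun ε hε => ?_
  obtain ⟨C, hC⟩ := exists_enorm_sub_apply_le_mkDist smul_eq dense_dom a hε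
  have := hC φ ψ
  rw [h, mul_zero, add_zero, ← ofReal_norm, ENNReal.ofReal_le_ofReal_iff hε.le] at this
  linarith

lemma StateSpace.continuous_eval (a : A) :
    Continuous[weakStarTopology A, _] fun φ : StateSpace A => φ.1 a :=
  (WeakDual.eval_continuous a).comp continuous_subtype_val

lemma StateSpace.nhds_le_of_tendsto {F : Filter (StateSpace A)} {φ : StateSpace A}
    (h : ∀ a : selfAdjoint A, Tendsto (fun ψ : StateSpace A => ψ.1 (a : A)) F (𝓝 (φ.1 (a : A)))) :
    F ≤ @nhds _ (weakStarTopology A) φ := by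
  rw [← tendsto_id', tendsto_subtype_rng,
    _root_.tendsto_iff_forall_eval_tendsto_topDualPairing]
  intro a
  change Tendsto (fun ψ : StateSpace A => ψ.1 a) F (𝓝 (φ.1 a))
  rw [← realPart_add_I_smul_imaginaryPart a]
  simp only [map_add, map_smul]
  exact (h _).add ((h _).const_smul _)

variable
  (add_le : ∀ a b, L (a + b) ≤ L a + L b)
  (smul_eq : ∀ (r : ℝ) (a), L (r • a) = ENNReal.ofReal |r| * L a)
  (dense_dom : Dense {a | L a < ∞})
  (eq_zero_iff : ∀ a, L a = 0 ↔ ∃ r : ℝ, a = r • (1 : selfAdjoint A))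
  (φ₀ : StateSpace A) (hK : TotallyBounded {a : selfAdjoint A | L a ≤ 1 ∧ φ₀.1 (a : A) = 0})

/-- The translate of a self-adjoint element by the scalar that makes it vanish on `φ₀`. -/
noncomputable def centered (φ₀ : StateSpace A) (a : selfAdjoint A) : selfAdjoint A :=
  a + (-(φ₀.1 (a : A)).re) • (1 : selfAdjoint A)

lemma apply_centered (φ : StateSpace A) (a : selfAdjoint A) :
    φ.1 (centered φ₀ a : A) = φ.1 (a : A) - φ₀.1 (a : A) := by
  have : (centered φ₀ a : A) = a + (-φ₀.1 (a : A)) • (1 : A) := by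
    rw [φ₀.apply_selfAdjoint a]
    simp [centered]
  rw [this, map_add, map_smul, φ.2.1]
  simp [sub_eq_add_neg]

lemma L_centered_le (add_le : ∀ a b, L (a + b) ≤ L a + L b)
    (eq_zero_iff : ∀ a, L a = 0 ↔ ∃ r : ℝ, a = r • (1 : selfAdjoint A)) (a : selfAdjoint A) :
    L (centered φ₀ a) ≤ L a := by
  refine (add_le _ _).trans ?_
  rw [(eq_zero_iff _).mpr ⟨_, rfl⟩, add_zero]

lemma centered_mem (add_le : ∀ a b, L (a + b) ≤ L a + L b)
    (eq_zero_iff : ∀ a, L a = 0 ↔ ∃ r : ℝ, a = r • (1 : selfAdjoint A)) {a : selfAdjoint A}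
    (ha : L a ≤ 1) : centered φ₀ a ∈ {a : selfAdjoint A | L a ≤ 1 ∧ φ₀.1 (a : A) = 0} :=
  ⟨(L_centered_le φ₀ add_le eq_zero_iff a).trans ha, by rw [apply_centered, sub_self]⟩

lemma apply_sub_apply_eq_centered (φ ψ : StateSpace A) (a : selfAdjoint A) :
    φ.1 (a : A) - ψ.1 (a : A) = φ.1 (centered φ₀ a : A) - ψ.1 (centered φ₀ a : A) := by
  rw [apply_centered, apply_centered]; ring

include add_le eq_zero_iff hK

lemma mkDist_ne_top (φ ψ : StateSpace A) : mkDist L φ ψ ≠ ⊤ := by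
  obtain ⟨R, hR⟩ := hK.isBounded.exists_norm_le
  refine ne_top_of_le_ne_top (ENNReal.ofReal_ne_top (r := 2 * R)) (iSup₂_le fun a ha => ?_)
  rw [apply_sub_apply_eq_centered φ₀, ← ofReal_norm]
  refine ENNReal.ofReal_le_ofReal ((φ.norm_sub_apply_le ψ _).trans ?_)
  have := hR _ (centered_mem φ₀ add_le eq_zero_iff ha)
  gcongr
  exact this

/-- Centering does not change differences of states, so a finite net of the totally bounded set
reduces the supremum to finitely many evaluations, each of which is weak* continuous. -/
lemma eventually_mkDist_lt (φ : StateSpace A) {ε : ℝ≥0∞} (hε : 0 < ε) :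
    ∀ᶠ ψ in @nhds _ (weakStarTopology A) φ, mkDist L ψ φ < ε := by
  obtain ⟨δ, hδ, hδε⟩ := ENNReal.lt_iff_exists_real_btwn.mp hε
  have hδ0 : 0 < δ := by simpa using hδε.1
  -- Passing to the net costs twice `δ/3`, as two states are involved; the last third is for the
  -- evaluation on the net.
  obtain ⟨t, ht, hcov⟩ := Metric.totallyBounded_iff.mp hK (δ / 3) (by positivity)
  have hev : ∀ᶠ ψ in @nhds _ (weakStarTopology A) φ, ∀ a ∈ t,
      ‖ψ.1 (a : A) - φ.1 (a : A)‖ < δ / 3 := by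
    rw [eventually_all_finite ht]
    intro a _
    have := (StateSpace.continuous_eval (a : A)).tendsto φ
    have := (Metric.tendsto_nhds.mp this) (δ / 3) (by positivity)
    simpa only [dist_eq_norm] using this
  filter_upwards [hev] with ψ hψ
  refine lt_of_le_of_lt (iSup₂_le fun b hb => ?_) hδε.2
  rw [apply_sub_apply_eq_centered φ₀, ← ofReal_norm]
  refine ENNReal.ofReal_le_ofReal ?_
  obtain ⟨a, hat, ha⟩ := Set.mem_iUnion₂.mp (hcov (centered_mem φ₀ add_le eq_zero_iff hb))
  set b' := centered φ₀ b
  have h1 := hψ a hat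
  have h2 := ψ.norm_sub_apply_le φ ((b' : A) - a)
  have h3 : ‖(b' : A) - a‖ < δ / 3 := by rw [← dist_eq_norm]; exact ha
  have h4 : ψ.1 (b' : A) - φ.1 (b' : A) = (ψ.1 ((b' : A) - a) - φ.1 ((b' : A) - a)) +
      (ψ.1 (a : A) - φ.1 (a : A)) := by
    rw [map_sub, map_sub]; ring
  rw [h4]
  refine (norm_add_le _ _).trans ?_
  linarith

include smul_eq dense_dom

/-- If the elements of the unit ball on which some state vanishes form a totally bounded set, then
the Monge-Kantorovich metric induces the weak* topology. -/
lemma exists_metricSpace_mkDist : ∃ m : MetricSpace (StateSpace A),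
    (∀ φ ψ, mkDist L φ ψ = ENNReal.ofReal (m.dist φ ψ)) ∧
    m.toUniformSpace.toTopologicalSpace = weakStarTopology A := by
  let e : EMetricSpace (StateSpace A) :=
    { edist := mkDist L
      edist_self := mkDist_self
      edist_comm := mkDist_comm
      edist_triangle := mkDist_triangle
      eq_of_edist_eq_zero := eq_of_mkDist_eq_zero smul_eq dense_dom }
  have hfin : ∀ φ ψ : StateSpace A, e.edist φ ψ ≠ ⊤ :=
    mkDist_ne_top add_le eq_zero_iff φ₀ hK
  refine ⟨@EMetricSpace.toMetricSpace _ e hfin, fun φ ψ => ?_, ?_⟩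
  · exact (ENNReal.ofReal_toReal (hfin φ ψ)).symm
  · refine TopologicalSpace.ext_nhds fun φ => ?_
    have hB := @Metric.nhds_basis_eball _ e.toPseudoEMetricSpace φ
    change (@nhds _ e.toUniformSpace.toTopologicalSpace φ).HasBasis _ _ at hB
    -- Density of the domain makes the metric topology finer than the weak* topology; total
    -- boundedness gives the converse.
    refine le_antisymm ?_ ?_
    · refine StateSpace.nhds_le_of_tendsto fun a => ?_
      rw [Metric.tendsto_nhds]
      intro ε hε
      obtain ⟨C, hC⟩ := exists_enorm_sub_apply_le_mkDist smul_eq dense_dom a (half_pos hε)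
      have hδ : (0 : ℝ≥0∞) < ENNReal.ofReal (ε / 2 / (C + 1)) := by
        rw [ENNReal.ofReal_pos]; positivity
      filter_upwards [hB.mem_of_mem hδ] with ψ hψ
      have hψ : mkDist L ψ φ < ENNReal.ofReal (ε / 2 / (C + 1)) := hψ
      have h1 := hC ψ φ
      have h2 : (C : ℝ≥0∞) * mkDist L ψ φ ≤ ENNReal.ofReal (C * (ε / 2 / (C + 1))) := by
        rw [ENNReal.ofReal_mul C.coe_nonneg, ENNReal.ofReal_coe_nnreal]
        gcongr
      have h3 := h1.trans (add_le_add le_rfl h2)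
      rw [← ENNReal.ofReal_add (by positivity) (by positivity), ← ofReal_norm,
        ENNReal.ofReal_le_ofReal_iff (by positivity)] at h3
      rw [dist_eq_norm]
      refine h3.trans_lt ?_
      have : (C : ℝ) * (ε / 2 / (C + 1)) < ε / 2 := by
        rw [mul_div_assoc', div_lt_iff₀ (by positivity)]
        nlinarith [C.coe_nonneg]
      linarith
    · rw [hB.ge_iff]
      exact fun ε hε => eventually_mkDist_lt add_le eq_zero_iff φ₀ hK φ hε

end LipNormCriterion

/-! ### The Lipschitz seminorm -/

section Lip

variable {A : Type v} [CStarAlgebra A] {X : Type u} [MetricSpace X]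

lemma lipSeminorm_le_iff {f : C(X, A)} {c : ℝ≥0∞} :
    lipSeminorm f ≤ c ↔ ∀ x y, ‖f x - f y‖ₑ ≤ c * edist x y := by
  simp only [lipSeminorm, iSup_le_iff]
  refine forall₂_congr fun x y => ?_
  rcases eq_or_ne x y with rfl | h
  · simp
  · exact ENNReal.div_le_iff_le_mul (.inl (edist_pos.mpr h).ne') (.inl (edist_ne_top x y))

lemma enorm_sub_le_lipSeminorm_mul (f : C(X, A)) (x y : X) :
    ‖f x - f y‖ₑ ≤ lipSeminorm f * edist x y :=
  lipSeminorm_le_iff.mp le_rfl x y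

lemma norm_sub_le_of_lipSeminorm_le_one {f : C(X, A)} (hf : lipSeminorm f ≤ 1) (x y : X) :
    ‖f x - f y‖ ≤ dist x y := by
  have h := lipSeminorm_le_iff.mp hf x y
  rwa [one_mul, edist_dist, ← ofReal_norm, ENNReal.ofReal_le_ofReal_iff dist_nonneg] at h

lemma lipSeminorm_add_le (f g : C(X, A)) :
    lipSeminorm (f + g) ≤ lipSeminorm f + lipSeminorm g := by
  rw [lipSeminorm_le_iff]
  intro x y
  calc ‖(f + g) x - (f + g) y‖ₑ = ‖(f x - f y) + (g x - g y)‖ₑ := by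
        congr 1; simp only [ContinuousMap.add_apply]; abel
    _ ≤ _ := enorm_add_le _ _
    _ ≤ _ := add_le_add (enorm_sub_le_lipSeminorm_mul f x y) (enorm_sub_le_lipSeminorm_mul g x y)
    _ = _ := (add_mul _ _ _).symm

lemma lipSeminorm_smul (c : ℂ) (f : C(X, A)) :
    lipSeminorm (c • f) = ‖c‖ₑ * lipSeminorm f := by
  simp only [lipSeminorm, ENNReal.mul_iSup, ContinuousMap.smul_apply, ← smul_sub, enorm_smul,
    mul_div_assoc]

lemma lipSeminorm_comp_le {B : Type w} [CStarAlgebra B] {f : C(X, A)} {g : C(X, B)}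
    (h : ∀ x y, ‖g x - g y‖ ≤ ‖f x - f y‖) : lipSeminorm g ≤ lipSeminorm f := by
  refine iSup₂_mono fun x y => ?_
  gcongr
  exact enorm_le_iff_norm_le.mpr (h x y)

lemma lipSeminorm_congr {B : Type w} [CStarAlgebra B] {f : C(X, A)} {g : C(X, B)}
    (h : ∀ x y, ‖g x - g y‖ = ‖f x - f y‖) : lipSeminorm g = lipSeminorm f :=
  le_antisymm (lipSeminorm_comp_le fun x y => (h x y).le)
    (lipSeminorm_comp_le fun x y => (h x y).ge)

lemma lipSeminorm_eq_zero_iff {f : C(X, A)} : lipSeminorm f = 0 ↔ ∀ x y, f x = f y := by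
  rw [← nonpos_iff_eq_zero, lipSeminorm_le_iff]
  refine forall₂_congr fun x y => ?_
  rw [zero_mul, nonpos_iff_eq_zero, enorm_eq_zero, sub_eq_zero]

/-- The elementary tensor `f ⊗ a` as a function. -/
noncomputable def elementary (f : C(X, ℂ)) (a : A) : C(X, A) :=
  ⟨fun x => f x • a, f.continuous.smul continuous_const⟩

@[simp]
lemma elementary_apply (f : C(X, ℂ)) (a : A) (x : X) : elementary f a x = f x • a := rfl

lemma lipSeminorm_elementary (f : C(X, ℂ)) (a : A) :
    lipSeminorm (elementary f a) = lipSeminorm f * ‖a‖ₑ := by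
  simp only [lipSeminorm, ENNReal.iSup_mul, elementary_apply, ← sub_smul, enorm_smul]
  simp only [div_eq_mul_inv, mul_right_comm]

variable [CompactSpace X]

lemma enorm_mul_le_mul_enorm (a b : A) : ‖a * b‖ₑ ≤ ‖a‖ₑ * ‖b‖ₑ := by
  rw [← ofReal_norm, ← ofReal_norm, ← ofReal_norm, ← ENNReal.ofReal_mul (norm_nonneg _)]
  exact ENNReal.ofReal_le_ofReal (norm_mul_le a b)

lemma ContinuousMap.enorm_apply_le (f : C(X, A)) (x : X) : ‖f x‖ₑ ≤ ‖f‖ₑ :=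
  enorm_le_iff_norm_le.mpr (f.norm_coe_le_norm x)

lemma lipSeminorm_mul_le (f g : C(X, A)) :
    lipSeminorm (f * g) ≤ lipSeminorm f * ‖g‖ₑ + lipSeminorm g * ‖f‖ₑ := by
  rw [lipSeminorm_le_iff]
  intro x y
  calc ‖(f * g) x - (f * g) y‖ₑ = ‖(f x - f y) * g x + f y * (g x - g y)‖ₑ := by
        congr 1; simp only [ContinuousMap.mul_apply]; noncomm_ring
    _ ≤ ‖f x - f y‖ₑ * ‖g x‖ₑ + ‖f y‖ₑ * ‖g x - g y‖ₑ :=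
        (enorm_add_le _ _).trans (add_le_add (enorm_mul_le_mul_enorm _ _) (enorm_mul_le_mul_enorm _ _))
    _ ≤ (lipSeminorm f * edist x y) * ‖g‖ₑ + ‖f‖ₑ * (lipSeminorm g * edist x y) := by
        gcongr
        · exact enorm_sub_le_lipSeminorm_mul f x y
        · exact g.enorm_apply_le x
        · exact f.enorm_apply_le y
        · exact enorm_sub_le_lipSeminorm_mul g x y
    _ = _ := by ring

-- Off the diagonal each quotient is continuous in `f`; on it the quotient is `0 / 0 = 0`. Suprema
-- of such functions are lower semicontinuous.
omit [CompactSpace X] in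
lemma lowerSemicontinuous_lipSeminorm :
    LowerSemicontinuous (lipSeminorm : C(X, A) → ℝ≥0∞) := by
  refine lowerSemicontinuous_iSup fun x => lowerSemicontinuous_iSup fun y => ?_
  rcases eq_or_ne x y with rfl | h
  · simpa using lowerSemicontinuous_const
  · refine Continuous.lowerSemicontinuous ?_
    refine (ENNReal.continuous_div_const _ (edist_pos.mpr h).ne').comp ?_
    exact continuous_enorm.comp ((continuous_eval_const x).sub
      (continuous_eval_const y))

end Lip

/-! ### The seminorm of an AF algebra -/

section AF

variable {A : Type v} [CStarAlgebra A] (τ : StateSpace A) (I : ℕ → StarSubalgebra ℂ A) (β : ℕ → ℝ)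

lemma afSeminorm_add_le (a b : A) :
    afSeminorm τ I β (a + b) ≤ afSeminorm τ I β a + afSeminorm τ I β b := by
  refine iSup_le fun n => ?_
  calc ‖a + b - (condExp τ (I n) (a + b) : A)‖ₑ / ENNReal.ofReal (β n)
      ≤ (‖a - (condExp τ (I n) a : A)‖ₑ + ‖b - (condExp τ (I n) b : A)‖ₑ) /
        ENNReal.ofReal (β n) := by
        gcongr
        rw [map_add, AddMemClass.coe_add, add_sub_add_comm]
        exact enorm_add_le _ _
    _ = _ := ENNReal.add_div
    _ ≤ _ := add_le_add
      (le_iSup (fun n => ‖a - (condExp τ (I n) a : A)‖ₑ / ENNReal.ofReal (β n)) n)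
      (le_iSup (fun n => ‖b - (condExp τ (I n) b : A)‖ₑ / ENNReal.ofReal (β n)) n)

lemma afSeminorm_smul (c : ℂ) (a : A) :
    afSeminorm τ I β (c • a) = ‖c‖ₑ * afSeminorm τ I β a := by
  simp only [afSeminorm, ENNReal.mul_iSup, map_smul, SetLike.val_smul, ← smul_sub, enorm_smul,
    mul_div_assoc]

lemma lowerSemicontinuous_afSeminorm (hβ : ∀ n, 0 < β n) :
    LowerSemicontinuous (afSeminorm τ I β) := by
  refine lowerSemicontinuous_iSup fun n => Continuous.lowerSemicontinuous ?_
  refine (ENNReal.continuous_div_const _ (by simpa using hβ n)).comp ?_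
  exact continuous_enorm.comp (continuous_id.sub
    (continuous_subtype_val.comp (condExp τ (I n)).continuous))

lemma enorm_sub_condExp_le (hβ : ∀ n, 0 < β n) (n : ℕ) (a : A) :
    ‖a - (condExp τ (I n) a : A)‖ₑ ≤ afSeminorm τ I β a * ENNReal.ofReal (β n) := by
  rw [← ENNReal.div_le_iff_le_mul (.inl (by simpa using hβ n)) (.inl ENNReal.ofReal_ne_top)]
  exact le_iSup (fun n => ‖a - (condExp τ (I n) a : A)‖ₑ / ENNReal.ofReal (β n)) n

variable {τ I β} [∀ n, FiniteDimensional ℂ (I n)] (hτ : τ.IsFaithful) (hτ' : τ.IsTracial)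
include hτ hτ'

lemma afSeminorm_mul_le (a b : A) : afSeminorm τ I β (a * b) ≤
    2 * (afSeminorm τ I β a * ‖b‖ₑ + afSeminorm τ I β b * ‖a‖ₑ) := by
  refine iSup_le fun n => ?_
  have h : ‖a * b - (condExp τ (I n) (a * b) : A)‖ₑ ≤
      2 * (‖a - (condExp τ (I n) a : A)‖ₑ * ‖b‖ₑ + ‖b - (condExp τ (I n) b : A)‖ₑ * ‖a‖ₑ) := by
    have h := norm_mul_sub_condExp_le τ (I n) hτ hτ' a b
    have := ENNReal.ofReal_le_ofReal h
    rw [ENNReal.ofReal_mul zero_le_two, ENNReal.ofReal_add (by positivity) (by positivity),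
      ENNReal.ofReal_mul (norm_nonneg _), ENNReal.ofReal_mul (norm_nonneg _)] at this
    simpa only [ofReal_norm, ENNReal.ofReal_ofNat] using this
  calc _ ≤ 2 * (‖a - (condExp τ (I n) a : A)‖ₑ * ‖b‖ₑ +
        ‖b - (condExp τ (I n) b : A)‖ₑ * ‖a‖ₑ) / ENNReal.ofReal (β n) := by gcongr
    _ = 2 * (‖a - (condExp τ (I n) a : A)‖ₑ / ENNReal.ofReal (β n) * ‖b‖ₑ +
        ‖b - (condExp τ (I n) b : A)‖ₑ / ENNReal.ofReal (β n) * ‖a‖ₑ) := by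
      simp only [div_eq_mul_inv]; ring
    _ ≤ _ := by
      gcongr
      · exact le_iSup (fun n => ‖a - (condExp τ (I n) a : A)‖ₑ / ENNReal.ofReal (β n)) n
      · exact le_iSup (fun n => ‖b - (condExp τ (I n) b : A)‖ₑ / ENNReal.ofReal (β n)) n

lemma sub_condExp_eq_zero (hI : Monotone I) {a : A} {m n : ℕ} (ha : a ∈ I m) (hmn : m ≤ n) :
    a - (condExp τ (I n) a : A) = 0 := by
  rw [condExp_of_mem τ (I n) hτ hτ' (hI hmn ha), sub_self]

/-- `E_n` fixes `a` once `n ≥ m`, so only finitely many terms survive. -/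
lemma afSeminorm_eq_sup_range (hI : Monotone I) {a : A} {m : ℕ} (ha : a ∈ I m) :
    afSeminorm τ I β a = (Finset.range (m + 1)).sup fun n =>
      ‖a - (condExp τ (I n) a : A)‖ₑ / ENNReal.ofReal (β n) := by
  refine le_antisymm (iSup_le fun n => ?_) (Finset.sup_le fun n _ => le_iSup
    (fun n => ‖a - (condExp τ (I n) a : A)‖ₑ / ENNReal.ofReal (β n)) n)
  rcases le_or_gt m n with h | h
  · simp [sub_condExp_eq_zero hτ hτ' hI ha h]
  · exact Finset.le_sup (f := fun n => ‖a - (condExp τ (I n) a : A)‖ₑ / ENNReal.ofReal (β n))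
      (Finset.mem_range.mpr (by omega))

lemma afSeminorm_lt_top (hI : Monotone I) (hβ : ∀ n, 0 < β n) {a : A} {m : ℕ} (ha : a ∈ I m) :
    afSeminorm τ I β a < ∞ := by
  rw [afSeminorm_eq_sup_range hτ hτ' hI ha, Finset.sup_lt_iff (by simp)]
  exact fun n _ => ENNReal.div_lt_top enorm_ne_top (by simpa using hβ n)

/-- For `k ≤ n` one has `E_n a - E_k E_n a = E_n (a - E_k a)` and `E_n` is contractive; for `k ≥ n`
the term vanishes. -/
lemma afSeminorm_condExp_le (hI : Monotone I) (n : ℕ) (a : A) :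
    afSeminorm τ I β (condExp τ (I n) a : A) ≤ afSeminorm τ I β a := by
  refine iSup_mono fun k => ?_
  gcongr
  rw [enorm_le_iff_norm_le]
  rcases le_total n k with h | h
  · rw [sub_condExp_eq_zero hτ hτ' hI (condExp τ (I n) a).2 h, norm_zero]
    exact norm_nonneg _
  · have e : (condExp τ (I n) a : A) - (condExp τ (I k) (condExp τ (I n) a : A) : A) =
        (condExp τ (I n) (a - (condExp τ (I k) a : A)) : A) := by
      rw [condExp_condExp_of_le τ (I k) hτ hτ' (hI h), map_sub, AddSubgroupClass.coe_sub,
        condExp_of_mem τ (I n) hτ hτ' (hI h (condExp τ (I k) a).2)]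
    rw [e]
    exact norm_condExp_apply_le τ (I n) hτ hτ' _

lemma eq_smul_one_of_afSeminorm_eq_zero (hI0 : I 0 = ⊥) (hβ : ∀ n, 0 < β n) {a : A}
    (ha : afSeminorm τ I β a = 0) : a = τ.1 a • (1 : A) := by
  have h := enorm_sub_condExp_le τ I β hβ 0 a
  rw [ha, zero_mul, nonpos_iff_eq_zero, enorm_eq_zero, sub_eq_zero,
    condExp_eq_of_eq_bot τ (I 0) hτ hτ' hI0] at h
  exact h

lemma afSeminorm_smul_one (c : ℂ) : afSeminorm τ I β (c • (1 : A)) = 0 := by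
  rw [afSeminorm, ENNReal.iSup_eq_zero]
  intro n
  rw [condExp_of_mem τ (I n) hτ hτ' ((I n).smul_mem (I n).one_mem c)]
  simp

end AF

/-! ### The seminorm of a homogeneous algebra -/

section AH

variable {A : Type v} [CStarAlgebra A] {X : Type u} [MetricSpace X] [CompactSpace X]
  (τ : StateSpace A) (I : ℕ → StarSubalgebra ℂ A) (β : ℕ → ℝ)

/-- The sup norm lets the suprema over `n` and `x` be exchanged, which reduces the second summand of
`L` to the fibres. -/
lemma iSup_enorm_sub_condExpX_div (f : C(X, A)) :
    ⨆ n, ‖f - inclX (I n) (condExpX τ (I n) f)‖ₑ / ENNReal.ofReal (β n) =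
      ⨆ x, afSeminorm τ I β (f x) := by
  simp only [ContinuousMap.enorm_eq_iSup_enorm, ENNReal.iSup_div, afSeminorm]
  rw [iSup_comm]
  rfl

lemma ahSeminorm_eq (f : C(X, A)) :
    ahSeminorm τ I β f = lipSeminorm f + ⨆ x, afSeminorm τ I β (f x) := by
  rw [ahSeminorm, iSup_enorm_sub_condExpX_div]

lemma lipSeminorm_le_ahSeminorm (f : C(X, A)) : lipSeminorm f ≤ ahSeminorm τ I β f :=
  le_self_add

lemma afSeminorm_apply_le_ahSeminorm (f : C(X, A)) (x : X) :
    afSeminorm τ I β (f x) ≤ ahSeminorm τ I β f := by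
  rw [ahSeminorm_eq]
  exact (le_iSup (fun x => afSeminorm τ I β (f x)) x).trans le_add_self

lemma ahSeminorm_add_le (f g : C(X, A)) :
    ahSeminorm τ I β (f + g) ≤ ahSeminorm τ I β f + ahSeminorm τ I β g := by
  simp only [ahSeminorm_eq]
  rw [add_add_add_comm]
  refine add_le_add (lipSeminorm_add_le f g) (iSup_le fun x => ?_)
  exact (afSeminorm_add_le τ I β _ _).trans (add_le_add
    (le_iSup (fun x => afSeminorm τ I β (f x)) x) (le_iSup (fun x => afSeminorm τ I β (g x)) x))

lemma ahSeminorm_smul (c : ℂ) (f : C(X, A)) :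
    ahSeminorm τ I β (c • f) = ‖c‖ₑ * ahSeminorm τ I β f := by
  simp only [ahSeminorm_eq, lipSeminorm_smul, ContinuousMap.smul_apply, afSeminorm_smul,
    ← ENNReal.mul_iSup, mul_add]

lemma ahSeminorm_zero : ahSeminorm τ I β (0 : C(X, A)) = 0 := by
  have := ahSeminorm_smul τ I β 0 (0 : C(X, A))
  simpa using this

lemma ahSeminorm_neg (f : C(X, A)) : ahSeminorm τ I β (-f) = ahSeminorm τ I β f := by
  have := ahSeminorm_smul τ I β (-1) f
  simpa using this

lemma ahSeminorm_sum_lt_top {ι : Type*} (s : Finset ι) (f : ι → C(X, A))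
    (h : ∀ i ∈ s, ahSeminorm τ I β (f i) < ∞) : ahSeminorm τ I β (∑ i ∈ s, f i) < ∞ := by
  refine (Finset.le_sum_of_subadditive (ahSeminorm τ I β) (ahSeminorm_zero τ I β).le
    (ahSeminorm_add_le τ I β) s f).trans_lt ?_
  exact ENNReal.sum_lt_top.mpr h

lemma lowerSemicontinuous_ahSeminorm (hβ : ∀ n, 0 < β n) :
    LowerSemicontinuous (ahSeminorm τ I β : C(X, A) → ℝ≥0∞) := by
  simp only [funext (ahSeminorm_eq τ I β)]
  refine lowerSemicontinuous_lipSeminorm.add (lowerSemicontinuous_iSup fun x => ?_)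
  exact (lowerSemicontinuous_afSeminorm τ I β hβ).comp (continuous_eval_const x)

lemma ahSeminorm_elementary (f : C(X, ℂ)) (a : A) :
    ahSeminorm τ I β (elementary f a) =
      lipSeminorm f * ‖a‖ₑ + afSeminorm τ I β a * ‖f‖ₑ := by
  rw [ahSeminorm_eq, lipSeminorm_elementary, ContinuousMap.enorm_eq_iSup_enorm, mul_comm _ (⨆ _, _),
    ENNReal.iSup_mul]
  simp only [elementary_apply, afSeminorm_smul]

variable {τ I β} [∀ n, FiniteDimensional ℂ (I n)] (hτ : τ.IsFaithful) (hτ' : τ.IsTracial)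
include hτ hτ'

lemma ahSeminorm_mul_le (f g : C(X, A)) : ahSeminorm τ I β (f * g) ≤
    2 * (ahSeminorm τ I β f * ‖g‖ₑ + ahSeminorm τ I β g * ‖f‖ₑ) := by
  have h1 : lipSeminorm (f * g) ≤ 2 * (lipSeminorm f * ‖g‖ₑ + lipSeminorm g * ‖f‖ₑ) :=
    (lipSeminorm_mul_le f g).trans (le_mul_of_one_le_left (zero_le) one_le_two)
  have h2 : ⨆ x, afSeminorm τ I β ((f * g) x) ≤ 2 * ((⨆ x, afSeminorm τ I β (f x)) * ‖g‖ₑ +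
      (⨆ x, afSeminorm τ I β (g x)) * ‖f‖ₑ) := by
    refine iSup_le fun x => (afSeminorm_mul_le hτ hτ' (f x) (g x)).trans ?_
    gcongr
    · exact le_iSup (fun x => afSeminorm τ I β (f x)) x
    · exact g.enorm_apply_le x
    · exact le_iSup (fun x => afSeminorm τ I β (g x)) x
    · exact f.enorm_apply_le x
  simp only [ahSeminorm_eq]
  refine (add_le_add h1 h2).trans (le_of_eq ?_)
  ring

end AH

/-! ### Lipschitz partitions of unity -/

section Partition

variable {X : Type u} [MetricSpace X] [CompactSpace X]

/-- Write the difference as `((a - b) - (b/t)(s - t)) / s` and use `b/t ≤ 1`, `s ≥ c`. It bounds the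
Lipschitz constants of normalized bump functions. -/
lemma abs_div_sub_div_le {a b s t c d N : ℝ} (hc : 0 < c) (hs : c ≤ s) (ht : c ≤ t) (hb : 0 ≤ b)
    (hbt : b ≤ t) (hab : |a - b| ≤ d) (hst : |s - t| ≤ N * d) :
    |a / s - b / t| ≤ (1 + N) / c * d := by
  have hs0 : 0 < s := hc.trans_le hs
  have ht0 : 0 < t := hc.trans_le ht
  have e : a / s - b / t = ((a - b) - b / t * (s - t)) / s := by field_simp; ring
  rw [e, abs_div, abs_of_pos hs0]
  have h1 : |(a - b) - b / t * (s - t)| ≤ (1 + N) * d := by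
    refine (abs_sub _ _).trans ?_
    rw [abs_mul, abs_of_nonneg (div_nonneg hb ht0.le)]
    have h2 : b / t ≤ 1 := (div_le_one ht0).mpr hbt
    have h3 : b / t * |s - t| ≤ 1 * |s - t| := mul_le_mul_of_nonneg_right h2 (abs_nonneg _)
    linarith
  have h0 : 0 ≤ (1 + N) * d := (abs_nonneg _).trans h1
  calc _ ≤ (1 + N) * d / s := by gcongr
    _ ≤ (1 + N) * d / c := by gcongr
    _ = _ := by ring

variable (X) in
/-- A compact metric space has Lipschitz partitions of unity with arbitrarily small supports. -/
lemma exists_lipschitz_partition {δ : ℝ} (hδ : 0 < δ) :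
    ∃ (s : Finset X) (ψ : X → X → ℝ), (∀ i x, 0 ≤ ψ i x) ∧ (∀ x, ∑ i ∈ s, ψ i x = 1) ∧
      (∀ i x, ψ i x ≠ 0 → dist x i < δ) ∧ ∃ K : ℝ, ∀ i ∈ s, ∀ x y,
        |ψ i x - ψ i y| ≤ K * dist x y := by
  obtain ⟨t, -, htf, ht⟩ := (isCompact_univ (X := X)).finite_cover_balls hδ
  set s := htf.toFinset with hs
  let h : X → X → ℝ := fun i x => max (δ - dist x i) 0
  have hh0 : ∀ i x, 0 ≤ h i x := fun i x => le_max_right _ _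
  have hcont : ∀ i, Continuous (h i) := fun i => by fun_prop
  have hlip : ∀ i x y, |h i x - h i y| ≤ dist x y := by
    intro i x y
    refine (abs_max_sub_max_le_abs _ _ _).trans ?_
    rw [sub_sub_sub_cancel_left, abs_sub_comm]
    exact abs_dist_sub_le x y i
  let S : X → ℝ := fun x => ∑ i ∈ s, h i x
  have hS : Continuous S := continuous_finsetSum _ fun i _ => hcont i
  have hSpos : ∀ x, 0 < S x := by
    intro x
    obtain ⟨i, hi, hx⟩ := Set.mem_iUnion₂.mp (ht (Set.mem_univ x))
    refine Finset.sum_pos' (fun i _ => hh0 i x) ⟨i, by simpa [hs] using hi, ?_⟩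
    exact lt_max_of_lt_left (sub_pos.mpr hx)
  -- The positive continuous sum attains its minimum by compactness; for empty `X` any constant will
  -- do.
  obtain ⟨c, hc, hcS⟩ : ∃ c : ℝ, 0 < c ∧ ∀ x, c ≤ S x := by
    rcases isEmpty_or_nonempty X with hX | hX
    · exact ⟨1, one_pos, fun x => hX.elim x⟩
    · obtain ⟨x₀, -, hx₀⟩ := isCompact_univ.exists_isMinOn Set.univ_nonempty hS.continuousOn
      exact ⟨S x₀, hSpos x₀, fun x => hx₀ (Set.mem_univ x)⟩
  refine ⟨s, fun i x => h i x / S x, fun i x => div_nonneg (hh0 i x) (hSpos x).le, fun x => ?_,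
    fun i x hne => ?_, (1 + s.card) / c, fun i hi x y => ?_⟩
  · rw [← Finset.sum_div]; exact div_self (hSpos x).ne'
  · by_contra! hle
    exact hne (by simp [h, hle])
  · refine abs_div_sub_div_le hc (hcS x) (hcS y) (hh0 i y)
      (Finset.single_le_sum (f := fun i => h i y) (fun i _ => hh0 i y) hi) (hlip i x y) ?_
    rw [← Finset.sum_sub_distrib]
    refine (Finset.abs_sum_le_sum_abs _ _).trans ?_
    refine (Finset.sum_le_card_nsmul _ _ _ fun i _ => hlip i x y).trans ?_
    simp

variable (X) in
/-- Functions that vary little at the scale `δ` are approximated by finite sums of elementary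
tensors with Lipschitz scalar factors that depend on `δ` only. -/
lemma exists_elementary_approx (A : Type v) [CStarAlgebra A] {δ : ℝ} (hδ : 0 < δ) :
    ∃ (s : Finset X) (ψ : X → C(X, ℂ)), (∀ i ∈ s, lipSeminorm (ψ i) < ∞) ∧
      (∀ i ∈ s, IsSelfAdjoint (ψ i)) ∧
      ∀ (f : C(X, A)) (ε : ℝ) (b : X → A), 0 ≤ ε →
        (∀ i ∈ s, ∀ x, dist x i < δ → ‖f x - b i‖ ≤ ε) →
        ‖f - ∑ i ∈ s, elementary (ψ i) (b i)‖ ≤ ε := by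
  classical
  obtain ⟨s, ψ, hpos, hsum, hsupp, K, hK⟩ := exists_lipschitz_partition X hδ
  have hcont : ∀ i ∈ s, Continuous (ψ i) := fun i hi =>
    (LipschitzWith.of_dist_le_mul (K := K.toNNReal) fun x y => by
      rw [Real.dist_eq]
      refine (hK i hi x y).trans ?_
      gcongr
      exact Real.le_coe_toNNReal K).continuous
  let Ψ : X → C(X, ℂ) := fun i =>
    if hi : i ∈ s then ⟨fun x => (ψ i x : ℂ), Complex.continuous_ofReal.comp (hcont i hi)⟩ else 0
  have hΨ : ∀ i ∈ s, ∀ x, Ψ i x = (ψ i x : ℂ) := fun i hi x => by simp [Ψ, hi]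
  refine ⟨s, Ψ, fun i hi => ?_, fun i hi => ?_, fun f ε b hε hb => ?_⟩
  · refine lt_of_le_of_lt (b := ENNReal.ofReal K) (lipSeminorm_le_iff.mpr fun x y => ?_)
      ENNReal.ofReal_lt_top
    rw [hΨ i hi, hΨ i hi, ← Complex.ofReal_sub, ← ofReal_norm, Complex.norm_real, edist_dist,
      ← ENNReal.ofReal_mul' dist_nonneg]
    exact ENNReal.ofReal_le_ofReal (hK i hi x y)
  · refine ContinuousMap.ext fun x => ?_
    rw [ContinuousMap.star_apply, hΨ i hi]
    simp
  · rw [ContinuousMap.norm_le _ hε]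
    intro x
    -- As the `ψ i` sum to 1, the error at `x` is a convex combination of the `f x - b i` with `x`
    -- near `i`.
    have e : (f - ∑ i ∈ s, elementary (Ψ i) (b i)) x = ∑ i ∈ s, (ψ i x : ℂ) • (f x - b i) := by
      have h1 : ∑ i ∈ s, (ψ i x : ℂ) • f x = f x := by
        rw [← Finset.sum_smul, ← Complex.ofReal_sum, hsum, Complex.ofReal_one, one_smul]
      simp only [smul_sub, Finset.sum_sub_distrib, h1, ContinuousMap.sub_apply,
        ContinuousMap.sum_apply, elementary_apply]
      congr 1
      exact Finset.sum_congr rfl fun i hi => by rw [hΨ i hi]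
    rw [e]
    calc _ ≤ ∑ i ∈ s, ψ i x * ε := by
          refine norm_sum_le_of_le _ fun i hi => ?_
          rw [norm_smul, Complex.norm_real, Real.norm_of_nonneg (hpos i x)]
          by_cases h0 : ψ i x = 0
          · simp [h0]
          · exact mul_le_mul_of_nonneg_left (hb i hi x (hsupp i x h0)) (hpos i x)
      _ = ε := by rw [← Finset.sum_mul, hsum, one_mul]

end Partition

/-! ### Density of sums of elementary tensors with Lipschitz factors -/

section Density

variable {X : Type u} [MetricSpace X] [CompactSpace X] {A : Type v} [CStarAlgebra A]

/-- Every continuous function is a limit of finite sums of elementary tensors with Lipschitz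
scalar factors; the algebra factors may be taken from any set that approximates its values. -/
lemma exists_elementary_approx_of_forall (f : C(X, A)) (T : Set A) {ε : ℝ} (hε : 0 < ε)
    (hT : ∀ x, ∃ b ∈ T, ‖f x - b‖ ≤ ε / 2) :
    ∃ (s : Finset X) (ψ : X → C(X, ℂ)) (b : X → A), (∀ i ∈ s, lipSeminorm (ψ i) < ∞) ∧
      (∀ i ∈ s, IsSelfAdjoint (ψ i)) ∧ (∀ i, b i ∈ T) ∧
      ‖f - ∑ i ∈ s, elementary (ψ i) (b i)‖ ≤ ε := by
  obtain ⟨δ, hδ, hfδ⟩ := Metric.uniformContinuous_iff.mp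
    (CompactSpace.uniformContinuous_of_continuous f.continuous) (ε / 2) (half_pos hε)
  obtain ⟨s, ψ, h1, h2, h3⟩ := exists_elementary_approx X A hδ
  choose b hbT hb using hT
  refine ⟨s, ψ, b, h1, h2, hbT, h3 f ε b hε.le fun i _ x hx => ?_⟩
  have := hfδ hx
  rw [dist_eq_norm] at this
  calc ‖f x - b i‖ = ‖(f x - f i) + (f i - b i)‖ := by congr 1; abel
    _ ≤ _ := norm_add_le _ _
    _ ≤ ε / 2 + ε / 2 := add_le_add this.le (hb i)
    _ = ε := add_halves ε

end Density

/-! ### Homogeneous algebras as compact quantum metric spaces -/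

section Models

variable {X : Type u} [MetricSpace X] [CompactSpace X] {A : Type v} [CStarAlgebra A]
  {D : Type w} [CStarAlgebra D]

/-- The data of an AF algebra with a faithful tracial state and a null sequence of weights. -/
structure IsAFData (τ : StateSpace A) (I : ℕ → StarSubalgebra ℂ A) (β : ℕ → ℝ) : Prop where
  tracial : τ.IsTracial
  faithful : τ.IsFaithful
  zero : I 0 = ⊥
  mono : Monotone I
  dense : closure (⋃ n, (I n : Set A)) = Set.univ
  pos : ∀ n, 0 < β n
  lim : Tendsto β atTop (𝓝 0)

/-- `j` identifies `D` with the functions in `C(X, A)` that take their values in `S`. -/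
structure IsModel (j : D →⋆ₐ[ℂ] C(X, A)) (S : StarSubalgebra ℂ A) : Prop where
  injective : Function.Injective j
  apply_mem : ∀ d x, j d x ∈ S
  exists_eq : ∀ f : C(X, A), (∀ x, f x ∈ S) → ∃ d, j d = f

/-- The elements of `S` are approximated by elements of `S` that lie in some `I m`. -/
def IsApproximated (I : ℕ → StarSubalgebra ℂ A) (S : StarSubalgebra ℂ A) : Prop :=
  ∀ a ∈ S, ∀ ε > 0, ∃ m, ∃ b ∈ S, b ∈ I m ∧ ‖a - b‖ ≤ ε

lemma isApproximated_self (I : ℕ → StarSubalgebra ℂ A) (n : ℕ) : IsApproximated I (I n) :=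
  fun a ha ε hε => ⟨n, a, ha, ha, by simpa using hε.le⟩

variable {τ : StateSpace A} {I : ℕ → StarSubalgebra ℂ A} {β : ℕ → ℝ}

lemma IsAFData.isApproximated_top (h : IsAFData τ I β) : IsApproximated I ⊤ := by
  intro a _ ε hε
  have ha : a ∈ closure (⋃ n, (I n : Set A)) := by rw [h.dense]; trivial
  obtain ⟨b, hb, hab⟩ := Metric.mem_closure_iff.mp ha ε hε
  obtain ⟨m, hm⟩ := Set.mem_iUnion.mp hb
  exact ⟨m, b, trivial, hm, by rw [← dist_eq_norm]; exact hab.le⟩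

/-- Averaging an approximant with its adjoint keeps it in `S` and `I m` and does not worsen the
error. -/
lemma IsApproximated.exists_isSelfAdjoint {S : StarSubalgebra ℂ A} (hS : IsApproximated I S)
    {a : A} (ha : a ∈ S) (has : IsSelfAdjoint a) {ε : ℝ} (hε : 0 < ε) :
    ∃ m, ∃ b ∈ S, b ∈ I m ∧ IsSelfAdjoint b ∧ ‖a - b‖ ≤ ε := by
  obtain ⟨m, b, hbS, hbm, hab⟩ := hS a ha ε hε
  refine ⟨m, (2⁻¹ : ℂ) • (b + star b), S.smul_mem (add_mem hbS (star_mem hbS)) _,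
    (I m).smul_mem (add_mem hbm (star_mem hbm)) _, ?_, ?_⟩
  · simp [IsSelfAdjoint, star_smul, star_add, add_comm]
  · have e : a - (2⁻¹ : ℂ) • (b + star b) = (2⁻¹ : ℂ) • ((a - b) + star (a - b)) := by
      have h2 : a = (2⁻¹ : ℂ) • (a + a) := by
        rw [← two_smul ℂ a, smul_smul]; norm_num
      conv_lhs => rw [h2]
      rw [← smul_sub, star_sub, has.star_eq]
      congr 1
      abel
    rw [e, norm_smul]
    have h1 := norm_add_le (a - b) (star (a - b))
    rw [norm_star] at h1
    have h3 : ‖(2⁻¹ : ℂ)‖ = 2⁻¹ := by simp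
    rw [h3]
    linarith

variable {j : D →⋆ₐ[ℂ] C(X, A)} {S : StarSubalgebra ℂ A}

lemma IsModel.isometry (hj : IsModel j S) : Isometry j :=
  NonUnitalStarAlgHom.isometry j hj.injective

lemma IsModel.enorm_map (hj : IsModel j S) (d : D) : ‖j d‖ₑ = ‖d‖ₑ := by
  rw [← ofReal_norm, ← ofReal_norm, NonUnitalStarAlgHom.norm_map j hj.injective]

omit [CompactSpace X] in
lemma IsModel.isSelfAdjoint_of_map (hj : IsModel j S) {d : D} (h : IsSelfAdjoint (j d)) :
    IsSelfAdjoint d :=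
  hj.injective (by rw [map_star, h.star_eq])

omit [CompactSpace X] in
lemma isSelfAdjoint_apply {f : C(X, A)} (hf : IsSelfAdjoint f) (x : X) : IsSelfAdjoint (f x) := by
  have := DFunLike.congr_fun hf.star_eq x
  exact this

/-- The approximating sums have self-adjoint Lipschitz scalar factors and self-adjoint coefficients
in some `I m`, so every summand has finite seminorm. -/
lemma IsModel.dense_dom [∀ n, FiniteDimensional ℂ (I n)] (h : IsAFData τ I β) (hj : IsModel j S)
    (hS : IsApproximated I S) :
    Dense {d : selfAdjoint D | ahSeminorm τ I β (j d) < ∞} := by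
  rw [Metric.dense_iff]
  intro d ε hε
  set f := j d with hf
  have hfs : IsSelfAdjoint f := d.2.map j
  obtain ⟨s, ψ, b, h1, h2, h3, h4⟩ := exists_elementary_approx_of_forall f
    {b | b ∈ S ∧ IsSelfAdjoint b ∧ ∃ m, b ∈ I m} (half_pos hε) (fun x => by
      obtain ⟨m, b, hbS, hbm, hbs, hb⟩ := hS.exists_isSelfAdjoint (hj.apply_mem d x)
        (isSelfAdjoint_apply hfs x) (half_pos (half_pos hε))
      exact ⟨b, ⟨hbS, hbs, m, hbm⟩, hb⟩)
  obtain ⟨d', hd'⟩ := hj.exists_eq (∑ i ∈ s, elementary (ψ i) (b i)) (fun x => by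
    rw [ContinuousMap.sum_apply]
    exact sum_mem fun i _ => S.smul_mem (h3 i).1 _)
  have hsa : IsSelfAdjoint d' := by
    refine hj.isSelfAdjoint_of_map ?_
    rw [hd']
    refine sum_mem (S := selfAdjoint C(X, A)) fun i hi => ?_
    rw [selfAdjoint.mem_iff]
    refine ContinuousMap.ext fun x => ?_
    rw [ContinuousMap.star_apply, elementary_apply, star_smul, (h3 i).2.1.star_eq,
      (isSelfAdjoint_apply (h2 i hi) x).star_eq]
  refine ⟨⟨d', hsa⟩, ?_, ?_⟩
  · rw [Metric.mem_ball, dist_comm]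
    change dist (d : D) d' < ε
    rw [← hj.isometry.dist_eq, hd', dist_eq_norm]
    exact h4.trans_lt (half_lt_self hε)
  · change ahSeminorm τ I β (j d') < ∞
    rw [hd']
    refine ahSeminorm_sum_lt_top τ I β s _ fun i hi => ?_
    rw [ahSeminorm_elementary]
    obtain ⟨m, hm⟩ := (h3 i).2.2
    exact ENNReal.add_lt_top.mpr ⟨ENNReal.mul_lt_top (h1 i hi) enorm_lt_top,
      ENNReal.mul_lt_top (afSeminorm_lt_top h.faithful h.tracial h.mono h.pos hm) enorm_lt_top⟩

lemma totallyBounded_of_forall_approx {Y : Type*} [PseudoMetricSpace Y] {s : Set Y}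
    (h : ∀ ε > 0, ∃ t, TotallyBounded t ∧ ∀ y ∈ s, ∃ z ∈ t, dist y z ≤ ε) : TotallyBounded s := by
  rw [Metric.totallyBounded_iff]
  intro ε hε
  obtain ⟨t, ht, hst⟩ := h (ε / 2) (half_pos hε)
  obtain ⟨u, hu, htu⟩ := Metric.totallyBounded_iff.mp ht (ε / 2) (half_pos hε)
  refine ⟨u, hu, fun y hy => ?_⟩
  obtain ⟨z, hz, hyz⟩ := hst y hy
  obtain ⟨w, hw, hzw⟩ := Set.mem_iUnion₂.mp (htu hz)
  refine Set.mem_iUnion₂.mpr ⟨w, hw, ?_⟩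
  have hzw : dist z w < ε / 2 := hzw
  rw [Metric.mem_ball]
  linarith [dist_triangle y z w]

/-- The ball is equi-Lipschitz, so one partition of unity serves all its elements; replacing the
sampled values `f i` by `E_n (f i)` costs at most `β n` and leaves a compact set of coefficients. -/
lemma totallyBounded_ahSeminorm_ball [∀ n, FiniteDimensional ℂ (I n)] (h : IsAFData τ I β)
    (x₀ : X) : TotallyBounded {f : C(X, A) | ahSeminorm τ I β f ≤ 1 ∧ τ.1 (f x₀) = 0} := by
  refine totallyBounded_of_forall_approx fun ε hε => ?_
  obtain ⟨n, hn⟩ : ∃ n, β n < ε / 2 := (h.lim.eventually_lt_const (half_pos hε)).exists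
  obtain ⟨s, ψ, -, -, happ⟩ := exists_elementary_approx X A (half_pos hε)
  -- As `τ (f x₀) = 0`, `|τ (f x)|` is at most the diameter; `f x` is within `β 0` of the scalar `τ
  -- (f x)`.
  set R : ℝ := Metric.diam (Set.univ : Set X) + β 0 with hR
  let Φ : (s → I n) → C(X, A) := fun b => ∑ i : s, elementary (ψ i) (b i : A)
  have hΦ : Continuous Φ := by
    refine continuous_finsetSum _ fun i _ => ?_
    have hel : Continuous fun a : A => elementary (ψ i) a := by
      refine ContinuousMap.continuous_of_continuous_uncurry _ ?_
      exact ((ψ i).continuous.comp continuous_snd).smul continuous_fst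
    exact hel.comp (continuous_subtype_val.comp (continuous_apply i))
  have : ProperSpace (I n) := FiniteDimensional.proper ℂ (I n)
  refine ⟨Φ '' Metric.closedBall 0 R, ((isCompact_closedBall _ _).image hΦ).totallyBounded, ?_⟩
  rintro f ⟨hf1, hf0⟩
  have hlip := norm_sub_le_of_lipSeminorm_le_one ((lipSeminorm_le_ahSeminorm τ I β f).trans hf1)
  have haf : ∀ m x, ‖f x - (condExp τ (I m) (f x) : A)‖ ≤ β m := by
    intro m x
    have h1 := enorm_sub_condExp_le τ I β h.pos m (f x)
    have h2 := h1.trans (mul_le_of_le_one_left'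
      ((afSeminorm_apply_le_ahSeminorm τ I β f x).trans hf1))
    rwa [← ofReal_norm, ENNReal.ofReal_le_ofReal_iff (h.pos m).le] at h2
  have hbound : ∀ x, ‖f x‖ ≤ R := by
    intro x
    have h1 := haf 0 x
    rw [condExp_eq_of_eq_bot τ (I 0) h.faithful h.tracial h.zero] at h1
    have h2 : ‖τ.1 (f x) • (1 : A)‖ ≤ Metric.diam (Set.univ : Set X) := by
      rw [norm_smul]
      have h3 : ‖τ.1 (f x)‖ ≤ dist x x₀ := by
        have : τ.1 (f x) = τ.1 (f x - f x₀) := by rw [map_sub, hf0, sub_zero]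
        rw [this]
        exact (τ.2.norm_apply_le _).trans (hlip x x₀)
      have h4 : ‖(1 : A)‖ ≤ 1 := (IsStarProjection.one A).norm_le_one'
      calc _ ≤ dist x x₀ * 1 := by gcongr
        _ = dist x x₀ := mul_one _
        _ ≤ _ := Metric.dist_le_diam_of_mem isCompact_univ.isBounded trivial trivial
    calc ‖f x‖ = ‖τ.1 (f x) • (1 : A) + (f x - τ.1 (f x) • (1 : A))‖ := by congr 1; abel
      _ ≤ _ := norm_add_le _ _
      _ ≤ _ := add_le_add h2 h1
  refine ⟨_, ⟨fun i => condExp τ (I n) (f i), ?_, rfl⟩, ?_⟩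
  · rw [mem_closedBall_zero_iff, pi_norm_le_iff_of_nonneg
      (add_nonneg Metric.diam_nonneg (h.pos 0).le)]
    exact fun i => (norm_condExp_apply_le τ (I n) h.faithful h.tracial _).trans (hbound i)
  · have := happ f ε (fun i => (condExp τ (I n) (f i) : A)) hε.le fun i _ x hx => by
      calc ‖f x - (condExp τ (I n) (f i) : A)‖
          = ‖(f x - f i) + (f i - (condExp τ (I n) (f i) : A))‖ := by congr 1; abel
        _ ≤ _ := norm_add_le _ _
        _ ≤ ε / 2 + ε / 2 := add_le_add ((hlip x i).trans hx.le) ((haf n i).trans hn.le)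
        _ = ε := add_halves ε
    rw [dist_eq_norm]
    rw [← Finset.sum_coe_sort] at this
    exact this

lemma continuous_starAlgHom {B : Type*} [CStarAlgebra B] (ρ : D →⋆ₐ[ℂ] B) : Continuous ρ :=
  AddMonoidHomClass.continuous_of_bound ρ 1 fun a => by
    simpa using NonUnitalStarAlgHom.norm_apply_le ρ a

/-- The composition of a state with a unital *-homomorphism. -/
noncomputable def StateSpace.comp {B : Type*} [CStarAlgebra B] (φ : StateSpace B)
    (ρ : D →⋆ₐ[ℂ] B) : StateSpace D :=
  ⟨StrongDual.toWeakDual ((WeakDual.toStrongDual φ.1).comp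
    ⟨ρ.toAlgHom.toLinearMap, continuous_starAlgHom ρ⟩), by
      change φ.1 (ρ 1) = 1
      rw [map_one, φ.2.1], fun b => by
      change 0 ≤ φ.1 (ρ (star b * b))
      rw [map_mul, map_star]
      exact φ.2.2 _⟩

variable (A) in
/-- Evaluation at a point. -/
def evalStarAlgHom (x : X) : C(X, A) →⋆ₐ[ℂ] A where
  toFun f := f x
  map_one' := rfl
  map_mul' _ _ := rfl
  map_zero' := rfl
  map_add' _ _ := rfl
  commutes' _ := rfl
  map_star' _ := rfl

lemma ahSeminorm_eq_zero_iff [Nonempty X] [∀ n, FiniteDimensional ℂ (I n)] (h : IsAFData τ I β)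
    {f : C(X, A)} (hf : IsSelfAdjoint f) :
    ahSeminorm τ I β f = 0 ↔ ∃ r : ℝ, f = (r : ℂ) • (1 : C(X, A)) := by
  constructor
  · intro h0
    obtain ⟨x₀⟩ := ‹Nonempty X›
    have h1 : lipSeminorm f = 0 := le_antisymm (h0 ▸ lipSeminorm_le_ahSeminorm τ I β f) zero_le
    have h2 : afSeminorm τ I β (f x₀) = 0 :=
      le_antisymm (h0 ▸ afSeminorm_apply_le_ahSeminorm τ I β f x₀) zero_le
    have h3 := eq_smul_one_of_afSeminorm_eq_zero h.faithful h.tracial h.zero h.pos h2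
    refine ⟨(τ.1 (f x₀)).re, ContinuousMap.ext fun x => ?_⟩
    have := τ.apply_selfAdjoint ⟨f x₀, isSelfAdjoint_apply hf x₀⟩
    rw [ContinuousMap.smul_apply, ContinuousMap.one_apply, ← this]
    exact (lipSeminorm_eq_zero_iff.mp h1 x x₀).trans h3
  · rintro ⟨r, rfl⟩
    rw [ahSeminorm_smul, ahSeminorm_eq, lipSeminorm_eq_zero_iff.mpr fun _ _ => rfl]
    have := afSeminorm_smul_one (β := β) (I := I) h.faithful h.tracial 1
    rw [one_smul] at this
    simp [this]

/-- The seminorm turns every model into a compact quantum metric space. -/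
theorem IsModel.isCQMS [Nonempty X] [∀ n, FiniteDimensional ℂ (I n)] (h : IsAFData τ I β)
    (hj : IsModel j S) (hS : IsApproximated I S) :
    (QPair.of D fun d => ahSeminorm τ I β (j d)).IsCQMS 2 := by
  have hsmul : ∀ (r : ℝ) (a : selfAdjoint D), ahSeminorm τ I β (j (r • a : selfAdjoint D)) =
      ENNReal.ofReal |r| * ahSeminorm τ I β (j a) := by
    intro r a
    rw [selfAdjoint.val_smul, ← Complex.coe_smul, map_smul, ahSeminorm_smul, ← ofReal_norm,
      Complex.norm_real, Real.norm_eq_abs]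
  have hadd : ∀ a b : selfAdjoint D, ahSeminorm τ I β (j (a + b : selfAdjoint D)) ≤
      ahSeminorm τ I β (j a) + ahSeminorm τ I β (j b) := fun a b => by
    rw [AddSubgroup.coe_add, map_add]
    exact ahSeminorm_add_le τ I β _ _
  have hzero : ∀ a : selfAdjoint D, ahSeminorm τ I β (j a) = 0 ↔
      ∃ r : ℝ, a = r • (1 : selfAdjoint D) := by
    intro a
    rw [ahSeminorm_eq_zero_iff h (a.2.map j)]
    refine exists_congr fun r => ?_
    have : j ((r • (1 : selfAdjoint D) : selfAdjoint D) : D) = (r : ℂ) • (1 : C(X, A)) := by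
      rw [selfAdjoint.val_smul, ← Complex.coe_smul, map_smul, selfAdjoint.val_one, map_one]
    rw [← this, hj.injective.eq_iff, Subtype.ext_iff]
  have hdense := hj.dense_dom h hS
  obtain ⟨x₀⟩ := ‹Nonempty X›
  -- The state is evaluation at `x₀` followed by `τ`; total boundedness pulls back along the
  -- isometry `j`.
  have hK : TotallyBounded {a : selfAdjoint D | ahSeminorm τ I β (j a) ≤ 1 ∧
      (τ.comp ((evalStarAlgHom A x₀).comp j)).1 (a : D) = 0} := by
    have hiso : Isometry fun a : selfAdjoint D => j a := hj.isometry.comp isometry_subtype_coe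
    exact totallyBounded_preimage hiso.isUniformInducing (totallyBounded_ahSeminorm_ball h x₀)
  have hmul := ahSeminorm_mul_le (X := X) (β := β) (I := I) h.faithful h.tracial
  refine ⟨⟨hadd, hsmul, hdense, hzero,
    exists_metricSpace_mkDist hadd hsmul hdense hzero _ hK, ?_⟩, one_le_two, ?_, ?_⟩
  · exact (lowerSemicontinuous_ahSeminorm τ I β h.pos).comp
      (hj.isometry.continuous.comp continuous_subtype_val)
  · intro (a : selfAdjoint D) (b : selfAdjoint D)
    change ahSeminorm τ I β (j ((2⁻¹ : ℂ) • ((a : D) * b + b * a))) ≤ _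
    rw [map_smul, ahSeminorm_smul, map_add, map_mul, map_mul]
    have h1 := hmul (j a) (j b)
    have h2 := hmul (j b) (j a)
    rw [hj.enorm_map, hj.enorm_map] at h1 h2
    rw [add_comm (_ * _) (_ * _)] at h2
    refine (mul_le_mul' le_rfl ((ahSeminorm_add_le τ I β _ _).trans (add_le_add h1 h2))).trans ?_
    refine le_of_eq ?_
    -- The two products contribute equal bounds, so averaging them preserves the constant 2.
    have e : ‖(2⁻¹ : ℂ)‖ₑ * 2 = 1 := by
      rw [enorm_inv (by norm_num), ← ofReal_norm]
      simp [ENNReal.inv_mul_cancel]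
    rw [← two_mul, ← mul_assoc, e, one_mul]
    rfl
  · intro (a : selfAdjoint D) (b : selfAdjoint D)
    change ahSeminorm τ I β (j ((2 * Complex.I)⁻¹ • ((a : D) * b - b * a))) ≤ _
    rw [map_smul, ahSeminorm_smul, sub_eq_add_neg, map_add, map_neg, map_mul, map_mul]
    have h1 := hmul (j a) (j b)
    have h2 := hmul (j b) (j a)
    rw [hj.enorm_map, hj.enorm_map] at h1 h2
    rw [add_comm (_ * _) (_ * _), ← ahSeminorm_neg] at h2
    refine (mul_le_mul' le_rfl ((ahSeminorm_add_le τ I β _ _).trans (add_le_add h1 h2))).trans ?_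
    refine le_of_eq ?_
    have e : ‖(2 * Complex.I)⁻¹‖ₑ * 2 = 1 := by
      rw [enorm_inv (by simp), ← ofReal_norm]
      simp [ENNReal.inv_mul_cancel]
    rw [← two_mul, ← mul_assoc, e, one_mul]
    rfl

end Models

/-! ### The bridge between a homogeneous algebra and its finite-dimensional stages -/

section Propinquity

lemma hausDist_le {S : Type*} {d : S → S → ℝ≥0∞} {s t : Set S} {r : ℝ≥0∞}
    (h1 : ∀ x ∈ s, ∃ y ∈ t, d x y ≤ r) (h2 : ∀ y ∈ t, ∃ x ∈ s, d x y ≤ r) :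
    hausDist d s t ≤ r := by
  refine max_le (iSup₂_le fun x hx => ?_) (iSup₂_le fun y hy => ?_)
  · obtain ⟨y, hy, h⟩ := h1 x hx
    exact (iInf₂_le y hy).trans h
  · obtain ⟨x, hx, h⟩ := h2 y hy
    exact (iInf₂_le x hx).trans h

lemma levelSet_one {D : Type w} [CStarAlgebra D] : levelSet (1 : D) = Set.univ := by
  ext φ; simp [levelSet]

/-- Every state of `B` extends to `D`, so the dual image is the whole state space. -/
lemma hausDist_mkDist_dualImage_univ {B D : Type w} [CStarAlgebra B] [CStarAlgebra D]
    (L : selfAdjoint B → ℝ≥0∞) {ρ : B →⋆ₐ[ℂ] D} (hρ : Function.Injective ρ) :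
    hausDist (mkDist L) Set.univ (Bridge.dualImage ρ Set.univ) = 0 := by
  refine nonpos_iff_eq_zero.mp (hausDist_le (fun ψ _ => ⟨ψ, ?_, (mkDist_self ψ).le⟩)
    fun ψ _ => ⟨ψ, trivial, (mkDist_self ψ).le⟩)
  obtain ⟨φ, hφ⟩ := IsState.exists_extension ρ hρ ψ
  exact ⟨φ, trivial, fun a => (hφ a).symm⟩

variable {X : Type u} [MetricSpace X] [CompactSpace X] {A : Type v} [CStarAlgebra A]
  {τ : StateSpace A} {I : ℕ → StarSubalgebra ℂ A} {β : ℕ → ℝ}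

omit [CompactSpace X] in
lemma inclX_condExpX_apply (B : StarSubalgebra ℂ A) (f : C(X, A)) (x : X) :
    inclX B (condExpX τ B f) x = (condExp τ B (f x) : A) := rfl

omit [CompactSpace X] in
lemma isSelfAdjoint_inclX_condExpX (B : StarSubalgebra ℂ A) [FiniteDimensional ℂ B]
    (hτ : τ.IsFaithful) (hτ' : τ.IsTracial) {f : C(X, A)} (hf : IsSelfAdjoint f) :
    IsSelfAdjoint (inclX B (condExpX τ B f)) := by
  refine ContinuousMap.ext fun x => ?_
  rw [ContinuousMap.star_apply, inclX_condExpX_apply, ← StarMemClass.coe_star,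
    ← condExp_star τ B hτ hτ', (isSelfAdjoint_apply hf x).star_eq]

variable [∀ n, FiniteDimensional ℂ (I n)]

lemma ahSeminorm_condExpX_le (h : IsAFData τ I β) (n : ℕ) (f : C(X, A)) :
    ahSeminorm τ I β (inclX (I n) (condExpX τ (I n) f)) ≤ ahSeminorm τ I β f := by
  simp only [ahSeminorm_eq]
  refine add_le_add (lipSeminorm_comp_le fun x y => ?_) (iSup_mono fun x => ?_)
  · rw [inclX_condExpX_apply, inclX_condExpX_apply, ← AddSubgroupClass.coe_sub, ← map_sub]
    exact norm_condExp_apply_le τ (I n) h.faithful h.tracial _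
  · exact afSeminorm_condExp_le h.faithful h.tracial h.mono n (f x)

omit [∀ n, FiniteDimensional ℂ (I n)] in
lemma enorm_sub_condExpX_le (h : IsAFData τ I β) (n : ℕ) {f : C(X, A)}
    (hf : ahSeminorm τ I β f ≤ 1) :
    ‖f - inclX (I n) (condExpX τ (I n) f)‖ₑ ≤ ENNReal.ofReal (β n) := by
  rw [ContinuousMap.enorm_eq_iSup_enorm]
  refine iSup_le fun x => (enorm_sub_condExp_le τ I β h.pos n (f x)).trans ?_
  exact mul_le_of_le_one_left' ((afSeminorm_apply_le_ahSeminorm τ I β f x).trans hf)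

variable {D B : Type w} [CStarAlgebra D] [CStarAlgebra B] [Nonempty X]

/-- The bridge lives in `D` itself with pivot 1, so that its level set contains all states and only
the reach contributes. -/
lemma propinquity_le_of_isModel (h : IsAFData τ I β) {j : D →⋆ₐ[ℂ] C(X, A)} (hj : IsModel j ⊤)
    (ρ : B →⋆ₐ[ℂ] D) (n : ℕ) (hρ : IsModel (j.comp ρ) (I n)) :
    propinquity 2 (QPair.of D fun d => ahSeminorm τ I β (j d))
      (QPair.of B fun b => ahSeminorm τ I β (j (ρ b))) ≤ ENNReal.ofReal (β n) := by
  obtain ⟨x₀⟩ := id ‹Nonempty X›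
  have hinj : Function.Injective ρ := fun a b hab => hρ.injective (congrArg j hab)
  set P := QPair.of D fun d => ahSeminorm τ I β (j d) with hP
  set Q := QPair.of B fun b => ahSeminorm τ I β (j (ρ b)) with hQ
  have hPC := hj.isCQMS h h.isApproximated_top
  have hQC := hρ.isCQMS h (isApproximated_self I n)
  let γ : Bridge P Q :=
    { D := D
      pivot := 1
      levelSet_nonempty := by
        rw [levelSet_one]
        exact ⟨τ.comp ((evalStarAlgHom A x₀).comp j), trivial⟩
      left := StarAlgHom.id ℂ D
      right := ρ
      left_injective := Function.injective_id
      right_injective := hinj }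
  have hheight : γ.height = 0 := by
    refine nonpos_iff_eq_zero.mp (max_le ?_ ?_)
    · change hausDist _ _ (Bridge.dualImage (StarAlgHom.id ℂ D) (levelSet (1 : D))) ≤ 0
      rw [levelSet_one]
      exact (hausDist_mkDist_dualImage_univ P.L Function.injective_id).le
    · change hausDist _ _ (Bridge.dualImage ρ (levelSet (1 : D))) ≤ 0
      rw [levelSet_one]
      exact (hausDist_mkDist_dualImage_univ Q.L hinj).le
  have hbn : ∀ (a : D) (b : B), γ.bn (((a, 0) : P.carrier × Q.carrier) -
      ((0, b) : P.carrier × Q.carrier)) = ‖a + ρ b‖ₑ := by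
    intro a b
    change ‖(a - 0) * 1 - 1 * ρ (0 - b)‖ₑ = _
    congr 1
    simp
  have hreach : γ.reach ≤ ENNReal.ofReal (β n) := by
    refine hausDist_le ?_ ?_
    · rintro _ ⟨⟨(a : D), ha⟩, hLa, rfl⟩
      have ha : IsSelfAdjoint a := ha
      -- The bridge seminorm is evaluated at `(a, 0) - (0, b)` and equals `‖a + ρ b‖`, hence the
      -- minus sign in the witness `-E_n(a)`.
      have hLa : ahSeminorm τ I β (j a) ≤ 1 := hLa
      obtain ⟨b, hb⟩ := hρ.exists_eq (-inclX (I n) (condExpX τ (I n) (j a)))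
        fun x => neg_mem (condExp τ (I n) (j a x)).2
      have hbs : IsSelfAdjoint b := by
        refine hρ.isSelfAdjoint_of_map ?_
        rw [hb]
        exact (isSelfAdjoint_inclX_condExpX (I n) h.faithful h.tracial (ha.map j)).neg
      have hb' : j (ρ b) = -inclX (I n) (condExpX τ (I n) (j a)) := hb
      refine ⟨((0 : D), b), ⟨⟨b, hbs⟩, ?_, rfl⟩, ?_⟩
      · change ahSeminorm τ I β (j (ρ b)) ≤ 1
        rw [hb', ahSeminorm_neg]
        exact (ahSeminorm_condExpX_le h n (j a)).trans hLa
      · refine (hbn a b).trans_le ?_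
        rw [← hj.enorm_map, map_add, hb', ← sub_eq_add_neg]
        exact enorm_sub_condExpX_le h n hLa
    · rintro _ ⟨⟨(b : B), hb⟩, hLb, rfl⟩
      have hb : IsSelfAdjoint b := hb
      refine ⟨(-ρ b, (0 : B)), ⟨⟨-ρ b, (hb.map ρ).neg⟩, ?_, rfl⟩, ?_⟩
      · change ahSeminorm τ I β (j (-ρ b)) ≤ 1
        rw [map_neg, ahSeminorm_neg]
        exact hLb
      · refine (hbn (-ρ b) b).trans_le ?_
        simp
  refine (iInf_le _ (Trek.single (P := P) (Q := Q) hPC hQC γ)).trans ?_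
  change max γ.height γ.reach ≤ _
  rw [hheight]
  exact max_le zero_le hreach

end Propinquity

/-! ### Models of `C(X, A)` -/

section ContinuousModels

variable {X : Type u} [MetricSpace X] [CompactSpace X] {A : Type v} [CStarAlgebra A]
  {τ : StateSpace A} {I : ℕ → StarSubalgebra ℂ A} {β : ℕ → ℝ}

lemma isModel_id : IsModel (StarAlgHom.id ℂ C(X, A)) ⊤ :=
  ⟨Function.injective_id, fun _ _ => trivial, fun f _ => ⟨f, rfl⟩⟩

variable (X) in
/-- The inclusion of `C(X, B)` into `C(X, A)` as a *-homomorphism. -/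
noncomputable def inclXHom (B : StarSubalgebra ℂ A) [IsClosed (B : Set A)] :
    C(X, B) →⋆ₐ[ℂ] C(X, A) where
  toFun := inclX B
  map_one' := rfl
  map_mul' _ _ := rfl
  map_zero' := rfl
  map_add' _ _ := rfl
  commutes' _ := rfl
  map_star' _ := rfl

lemma isModel_inclXHom (B : StarSubalgebra ℂ A) [IsClosed (B : Set A)] :
    IsModel (inclXHom X B) B where
  injective _ _ hfg := ContinuousMap.ext fun x => Subtype.ext (DFunLike.congr_fun hfg x)
  apply_mem f x := (f x).2
  exists_eq f hf := ⟨⟨fun x => ⟨f x, hf x⟩, f.continuous.subtype_mk _⟩, rfl⟩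

variable [∀ n, FiniteDimensional ℂ (I n)] [Nonempty X] (h : IsAFData τ I β)
include h

lemma isCQMS_contPair : (contPair X τ I β).IsCQMS 2 := by
  have := (isModel_id (X := X)).isCQMS h h.isApproximated_top
  exact this

lemma isCQMS_contSubPair (n : ℕ) : (contSubPair X τ I β (I n)).IsCQMS 2 := by
  have := (isModel_inclXHom (X := X) (I n)).isCQMS h (isApproximated_self I n)
  exact this

lemma propinquity_contPair_le (n : ℕ) :
    propinquity 2 (contPair X τ I β) (contSubPair X τ I β (I n)) ≤ ENNReal.ofReal (β n) := by
  have := propinquity_le_of_isModel h (isModel_id (X := X)) (inclXHom X (I n)) n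
    (isModel_inclXHom (I n))
  exact this

omit [Nonempty X] in
lemma ahSeminorm_inclX_eq (n : ℕ) (f : C(X, I n)) :
    ahSeminorm τ I β (inclX (I n) f) = lipSeminorm f +
      (Finset.range (n + 1)).sup fun k =>
        ‖inclX (I n) f - inclX (I k) (condExpX τ (I k) (inclX (I n) f))‖ₑ /
          ENNReal.ofReal (β k) := by
  have h1 : lipSeminorm (inclX (I n) f) = lipSeminorm f := lipSeminorm_congr fun x y => rfl
  rw [ahSeminorm, h1]
  congr 1
  refine le_antisymm (iSup_le fun k => ?_) (Finset.sup_le fun k _ => le_iSup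
    (fun k => ‖inclX (I n) f - inclX (I k) (condExpX τ (I k) (inclX (I n) f))‖ₑ /
      ENNReal.ofReal (β k)) k)
  rcases le_or_gt n k with hk | hk
  · have : inclX (I n) f - inclX (I k) (condExpX τ (I k) (inclX (I n) f)) = 0 :=
      ContinuousMap.ext fun x =>
        sub_condExp_eq_zero h.faithful h.tracial h.mono (f x).2 hk
    rw [this]
    simp
  · exact Finset.le_sup (f := fun k =>
      ‖inclX (I n) f - inclX (I k) (condExpX τ (I k) (inclX (I n) f))‖ₑ / ENNReal.ofReal (β k))
      (Finset.mem_range.mpr (by omega))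

end ContinuousModels

/-! ### Completions of a *-algebra -/

section Completion

variable {M : Type*} [Semiring M] [Algebra ℂ M] [Star M] {C : Type u} {D : Type v}
  [CStarAlgebra C] [CStarAlgebra D]

/-- The joint range of two *-homomorphisms with the same domain. -/
def StarAlgHom.jointRange (p : M →⋆ₐ[ℂ] C) (q : M →⋆ₐ[ℂ] D) : StarSubalgebra ℂ (C × D) where
  carrier := Set.range fun m => (p m, q m)
  mul_mem' := by
    rintro _ _ ⟨m, rfl⟩ ⟨n, rfl⟩
    exact ⟨m * n, by simp⟩
  one_mem' := ⟨1, by simp⟩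
  add_mem' := by
    rintro _ _ ⟨m, rfl⟩ ⟨n, rfl⟩
    exact ⟨m + n, by simp⟩
  zero_mem' := ⟨0, by simp⟩
  algebraMap_mem' r := ⟨algebraMap ℂ M r, by
    simp only [AlgHomClass.commutes]
    rfl⟩
  star_mem' := by
    rintro _ ⟨m, rfl⟩
    exact ⟨star m, Prod.ext (map_star p m) (map_star q m)⟩

lemma StarAlgHom.norm_fst_eq_norm_snd {p : M →⋆ₐ[ℂ] C} {q : M →⋆ₐ[ℂ] D}
    (h : ∀ m, ‖p m‖ = ‖q m‖) {z : C × D} (hz : z ∈ (jointRange p q).topologicalClosure) :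
    ‖z.1‖ = ‖z.2‖ := by
  have hz : z ∈ closure (jointRange p q : Set (C × D)) := hz
  refine closure_minimal (t := {z : C × D | ‖z.1‖ = ‖z.2‖}) ?_ ?_ hz
  · rintro _ ⟨m, rfl⟩
    exact h m
  · exact isClosed_eq (by fun_prop) (by fun_prop)

/-- An injective *-homomorphism with dense range is bijective. -/
lemma StarAlgHom.bijective_of_denseRange {φ : C →⋆ₐ[ℂ] D} (hφ : Function.Injective φ)
    (hd : DenseRange φ) : Function.Bijective φ := by
  refine ⟨hφ, Set.range_eq_univ.mp ?_⟩
  rw [← (NonUnitalStarAlgHom.isometry φ hφ).isClosedEmbedding.isClosed_range.closure_eq]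
  exact hd.closure_range

/-- Two completions of a *-algebra in the same norm are isomorphic. -/
lemma exists_starAlgEquiv_of_norm_eq (p : M →⋆ₐ[ℂ] C) (q : M →⋆ₐ[ℂ] D) (hp : DenseRange p)
    (hq : DenseRange q) (h : ∀ m, ‖p m‖ = ‖q m‖) : ∃ π : C ≃⋆ₐ[ℂ] D, ∀ m, π (p m) = q m := by
  -- `G` is the closure of the joint range. Its coordinates have equal norms, so both projections
  -- are injective; their ranges are dense, so both are isomorphisms, and `G` is the graph of the
  -- required map.
  set G := (StarAlgHom.jointRange p q).topologicalClosure with hG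
  have : IsClosed (G : Set (C × D)) := StarSubalgebra.isClosed_topologicalClosure _
  have hmem : ∀ m, (p m, q m) ∈ G := fun m => StarSubalgebra.le_topologicalClosure _ ⟨m, rfl⟩
  let p' : G →⋆ₐ[ℂ] C := (StarAlgHom.fst ℂ C D).comp G.subtype
  let q' : G →⋆ₐ[ℂ] D := (StarAlgHom.snd ℂ C D).comp G.subtype
  have hn : ∀ z : G, ‖p' z‖ = ‖q' z‖ := fun z => StarAlgHom.norm_fst_eq_norm_snd h z.2
  have hp' : Function.Injective p' := by
    refine (injective_iff_map_eq_zero p').mpr fun z hz => Subtype.ext (Prod.ext hz ?_)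
    have := hn z
    rw [hz, norm_zero] at this
    exact norm_eq_zero.mp this.symm
  have hq' : Function.Injective q' := by
    refine (injective_iff_map_eq_zero q').mpr fun z hz => Subtype.ext (Prod.ext ?_ hz)
    have := hn z
    rw [hz, norm_zero] at this
    exact norm_eq_zero.mp this
  have hbp := StarAlgHom.bijective_of_denseRange hp'
    (hp.mono (by rintro _ ⟨m, rfl⟩; exact ⟨⟨_, hmem m⟩, rfl⟩))
  have hbq := StarAlgHom.bijective_of_denseRange hq'
    (hq.mono (by rintro _ ⟨m, rfl⟩; exact ⟨⟨_, hmem m⟩, rfl⟩))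
  let e := StarAlgEquiv.ofBijective p' hbp
  let e' := StarAlgEquiv.ofBijective q' hbq
  refine ⟨e.symm.trans e', fun m => ?_⟩
  have : e.symm (p m) = ⟨_, hmem m⟩ :=
    e.symm_apply_apply ⟨_, hmem m⟩
  rw [StarAlgEquiv.trans_apply, this]
  rfl

end Completion

/-! ### The algebraic tensor product inside `C(X, A)` -/

section AlgebraicTensor

variable (X : Type u) [MetricSpace X] (A : Type v) [CStarAlgebra A]

/-- The *-homomorphism from the algebraic tensor product to `C(X, A)`. -/
noncomputable def tensorToCont : C(X, ℂ) ⊗[ℂ] A →⋆ₐ[ℂ] C(X, A) :=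
  { Algebra.TensorProduct.algHomOfLinearMapTensorProduct (R := ℂ) (S := ℂ)
      (TensorProduct.lift (LinearMap.mk₂ ℂ (fun (f : C(X, ℂ)) (a : A) => elementary f a)
        (fun f g a => ContinuousMap.ext fun x => add_smul _ _ _)
        (fun c f a => ContinuousMap.ext fun x => smul_assoc c (f x) a)
        (fun f a b => ContinuousMap.ext fun x => smul_add _ _ _)
        (fun c f a => ContinuousMap.ext fun x => smul_comm (f x) c a)))
      (fun f g a b => ContinuousMap.ext fun x => (smul_mul_smul_comm (f x) a (g x) b).symm)
      (ContinuousMap.ext fun x => one_smul ℂ (1 : A)) with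
    map_star' := fun t => by
      change TensorProduct.lift _ (star t) = star (TensorProduct.lift _ t)
      induction t with
      | zero => simp
      | add s t hs ht => rw [star_add, map_add, map_add, hs, ht, star_add]
      | tmul f a =>
        rw [TensorProduct.star_tmul]
        exact ContinuousMap.ext fun x => (star_smul (f x) a).symm }

variable {X A}

@[simp]
lemma tensorToCont_tmul (f : C(X, ℂ)) (a : A) :
    tensorToCont X A (f ⊗ₜ[ℂ] a) = elementary f a := rfl

/-- In a linear basis of `A`, the coordinates of the function are the coefficient functions of the
tensor, evaluated pointwise. Hence the tensor can be recovered from the function. -/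
lemma repr_tensorToCont {κ : Type*} [DecidableEq κ] (b : Module.Basis κ ℂ A)
    (t : C(X, ℂ) ⊗[ℂ] A) (i : κ) (x : X) :
    b.repr (tensorToCont X A t x) i = TensorProduct.equivFinsuppOfBasisRight b t i x := by
  induction t with
  | zero => simp
  | add s t hs ht => simp [hs, ht]
  | tmul f a =>
    rw [TensorProduct.equivFinsuppOfBasisRight_apply_tmul_apply]
    simp [mul_comm]

lemma tensorToCont_injective : Function.Injective (tensorToCont X A) := by
  classical
  let b := Module.Basis.ofVectorSpace ℂ A
  intro s t hst
  refine (TensorProduct.equivFinsuppOfBasisRight b).injective (Finsupp.ext fun i =>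
    ContinuousMap.ext fun x => ?_)
  rw [← repr_tensorToCont, ← repr_tensorToCont, hst]

/-- In finite dimension the coordinates of a continuous function are continuous. -/
lemma tensorToCont_surjective [FiniteDimensional ℂ A] :
    Function.Surjective (tensorToCont X A) := by
  classical
  let b := Module.finBasis ℂ A
  intro f
  have hc : ∀ i, Continuous fun x => b.repr (f x) i := fun i =>
    ((LinearMap.continuous_of_finiteDimensional (b.coord i)).comp f.continuous)
  refine ⟨∑ i, (⟨_, hc i⟩ : C(X, ℂ)) ⊗ₜ[ℂ] b i, ContinuousMap.ext fun x => ?_⟩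
  rw [map_sum, ContinuousMap.sum_apply]
  exact b.sum_repr (f x)

lemma tensorToCont_denseRange [CompactSpace X] : DenseRange (tensorToCont X A) := by
  intro f
  rw [Metric.mem_closure_range_iff]
  intro ε hε
  obtain ⟨s, ψ, b, -, -, -, h⟩ := exists_elementary_approx_of_forall f Set.univ (half_pos hε)
    fun x => ⟨f x, trivial, by simpa using (half_pos (half_pos hε)).le⟩
  refine ⟨∑ i ∈ s, ψ i ⊗ₜ[ℂ] b i, ?_⟩
  rw [map_sum, dist_eq_norm]
  exact h.trans_lt (half_lt_self hε)

variable (X) in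
/-- The inclusion of algebraic tensor products that is induced by a *-subalgebra. -/
noncomputable def tensorIncl (B : StarSubalgebra ℂ A) :
    C(X, ℂ) ⊗[ℂ] B →⋆ₐ[ℂ] C(X, ℂ) ⊗[ℂ] A :=
  { Algebra.TensorProduct.map (AlgHom.id ℂ C(X, ℂ)) B.subtype.toAlgHom with
    map_star' := fun t => by
      change Algebra.TensorProduct.map _ _ (star t) = star (Algebra.TensorProduct.map _ _ t)
      induction t with
      | zero => simp
      | add s t hs ht => rw [star_add, map_add, map_add, hs, ht, star_add]
      | tmul f a => rfl }

lemma tensorIncl_tmul (B : StarSubalgebra ℂ A) (f : C(X, ℂ)) (b : B) :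
    tensorIncl X B (f ⊗ₜ[ℂ] b) = f ⊗ₜ[ℂ] (b : A) := rfl

lemma tensorToCont_tensorIncl (B : StarSubalgebra ℂ A) [IsClosed (B : Set A)]
    (t : C(X, ℂ) ⊗[ℂ] B) :
    tensorToCont X A (tensorIncl X B t) = inclXHom X B (tensorToCont X B t) := by
  induction t with
  | zero => simp
  | add s t hs ht => rw [map_add, map_add, hs, ht, map_add, map_add]
  | tmul f a => rfl

end AlgebraicTensor

/-! ### C*-norms on the algebraic tensor product -/

section CStarNorm

variable {X : Type u} [MetricSpace X] [CompactSpace X] {A : Type v} [CStarAlgebra A]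
  {C : Type w} [CStarAlgebra C] {p : C(X, ℂ) ⊗[ℂ] A →⋆ₐ[ℂ] C}

/-- On `C(X) ⊗ B` with `B` finite-dimensional, every C*-norm is the norm of `C(X, B)`. -/
lemma norm_tensorIncl_eq (hp : Function.Injective p) (B : StarSubalgebra ℂ A)
    [FiniteDimensional ℂ B] (t : C(X, ℂ) ⊗[ℂ] B) :
    ‖p (tensorIncl X B t)‖ = ‖tensorToCont X A (tensorIncl X B t)‖ := by
  let e := StarAlgEquiv.ofBijective (tensorToCont X B)
    ⟨tensorToCont_injective, tensorToCont_surjective⟩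
  -- The algebraic tensor product is the C*-algebra `C(X, B)`, so `p` becomes an injective, hence
  -- isometric, *-homomorphism on it.
  let σ : C(X, B) →⋆ₐ[ℂ] C := (p.comp (tensorIncl X B)).comp e.symm.toStarAlgHom
  have he : ∀ s, e.symm (tensorToCont X B s) = s := fun s => e.symm_apply_apply s
  have hincl : Function.Injective (tensorIncl X B) := fun s t hst => by
    have h := congrArg (tensorToCont X A) hst
    rw [tensorToCont_tensorIncl, tensorToCont_tensorIncl] at h
    exact tensorToCont_injective ((isModel_inclXHom B).injective h)
  have hσ : Function.Injective σ := (hp.comp hincl).comp (EquivLike.injective e.symm)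
  have h1 : ‖σ (tensorToCont X B t)‖ = ‖tensorToCont X B t‖ :=
    NonUnitalStarAlgHom.norm_map σ hσ _
  have h2 : σ (tensorToCont X B t) = p (tensorIncl X B t) :=
    congrArg (fun s => p (tensorIncl X B s)) (he t)
  rw [← h2, h1, tensorToCont_tensorIncl,
    NonUnitalStarAlgHom.norm_map _ (isModel_inclXHom (X := X) B).injective]

/-- Factor `f ⊗ a = (f ⊗ 1)(1 ⊗ a)`; the map `a ↦ p (1 ⊗ a)` is a *-homomorphism and therefore
contractive. -/
lemma exists_norm_tmul_le (p : C(X, ℂ) ⊗[ℂ] A →⋆ₐ[ℂ] C) (f : C(X, ℂ)) :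
    ∃ K : ℝ, 0 ≤ K ∧ ∀ a : A, ‖p (f ⊗ₜ[ℂ] a)‖ ≤ K * ‖a‖ := by
  refine ⟨‖p (f ⊗ₜ[ℂ] 1)‖, norm_nonneg _, fun a => ?_⟩
  let φ : A →⋆ₐ[ℂ] C :=
    { p.toAlgHom.comp Algebra.TensorProduct.includeRight with
      map_star' := fun a => by
        change p (1 ⊗ₜ[ℂ] star a) = star (p (1 ⊗ₜ[ℂ] a))
        rw [← map_star, TensorProduct.star_tmul, star_one] }
  have h1 : ‖p (1 ⊗ₜ[ℂ] a)‖ ≤ ‖a‖ := NonUnitalStarAlgHom.norm_apply_le φ a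
  have h2 : f ⊗ₜ[ℂ] a = (f ⊗ₜ[ℂ] (1 : A)) * ((1 : C(X, ℂ)) ⊗ₜ[ℂ] a) := by
    rw [Algebra.TensorProduct.tmul_mul_tmul, mul_one, one_mul]
  rw [h2, map_mul]
  exact (norm_mul_le _ _).trans (by gcongr)

variable {I : ℕ → StarSubalgebra ℂ A}

/-- One tensor approximates in both norms at once. Asking for all large `n` lets the approximants of
two summands share a stage. -/
lemma eventually_exists_tensorIncl_near (hI : Monotone I)
    (hd : closure (⋃ n, (I n : Set A)) = Set.univ) (p : C(X, ℂ) ⊗[ℂ] A →⋆ₐ[ℂ] C)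
    (t : C(X, ℂ) ⊗[ℂ] A) : ∀ ε > 0, ∀ᶠ n in atTop, ∃ s : C(X, ℂ) ⊗[ℂ] I n,
      ‖p (t - tensorIncl X (I n) s)‖ ≤ ε ∧
      ‖tensorToCont X A (t - tensorIncl X (I n) s)‖ ≤ ε := by
  induction t with
  | zero => exact fun ε hε => .of_forall fun n => ⟨0, by simpa using hε.le, by simpa using hε.le⟩
  | add s t hs ht =>
    intro ε hε
    filter_upwards [hs _ (half_pos hε), ht _ (half_pos hε)] with n ⟨s', h1, h2⟩ ⟨t', h3, h4⟩
    refine ⟨s' + t', ?_, ?_⟩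
    · rw [map_add, add_sub_add_comm, map_add]
      exact (norm_add_le _ _).trans ((add_le_add h1 h3).trans (add_halves ε).le)
    · rw [map_add, add_sub_add_comm, map_add]
      exact (norm_add_le _ _).trans ((add_le_add h2 h4).trans (add_halves ε).le)
  | tmul f a =>
    intro ε hε
    obtain ⟨K, hK, h1⟩ := exists_norm_tmul_le p f
    obtain ⟨K', hK', h2⟩ := exists_norm_tmul_le (tensorToCont X A) f
    have ha : a ∈ closure (⋃ n, (I n : Set A)) := by rw [hd]; trivial
    obtain ⟨b, hb, hab⟩ := Metric.mem_closure_iff.mp ha (ε / (K + K' + 1)) (by positivity)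
    obtain ⟨m, hm⟩ := Set.mem_iUnion.mp hb
    rw [dist_eq_norm, lt_div_iff₀ (by positivity)] at hab
    filter_upwards [eventually_ge_atTop m] with n hn
    refine ⟨f ⊗ₜ[ℂ] ⟨b, hI hn hm⟩, ?_, ?_⟩
    · rw [tensorIncl_tmul, ← TensorProduct.tmul_sub]
      refine (h1 _).trans ?_
      nlinarith [norm_nonneg (a - b)]
    · rw [tensorIncl_tmul, ← TensorProduct.tmul_sub]
      refine (h2 _).trans ?_
      nlinarith [norm_nonneg (a - b)]

/-- Every C*-norm on `C(X) ⊗ A` is the norm of `C(X, A)`. -/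
lemma norm_eq_norm_tensorToCont [∀ n, FiniteDimensional ℂ (I n)] (hI : Monotone I)
    (hd : closure (⋃ n, (I n : Set A)) = Set.univ) (hp : Function.Injective p)
    (t : C(X, ℂ) ⊗[ℂ] A) : ‖p t‖ = ‖tensorToCont X A t‖ := by
  rw [← sub_eq_zero, ← abs_nonpos_iff]
  refine le_of_forall_pos_le_add fun ε hε => ?_
  obtain ⟨n, s, h1, h2⟩ :=
    (eventually_exists_tensorIncl_near hI hd p t _ (half_pos hε)).exists
  have h3 := norm_tensorIncl_eq hp (I n) s
  rw [map_sub] at h1 h2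
  have h4 := (abs_norm_sub_norm_le _ _).trans h1
  have h5 := (abs_norm_sub_norm_le _ _).trans h2
  rw [abs_le] at h4 h5 ⊢
  constructor <;> linarith

end CStarNorm

/-! ### C*-tensor products with `C(X)` -/

section CanonicalIso

variable {X : Type u} [MetricSpace X] [CompactSpace X] {A : Type v} [CStarAlgebra A]

variable (X A) in
/-- `C(X, A)` is a C*-tensor product of `C(X)` and `A`. -/
lemma nonempty_cstarTensor : Nonempty (CStarTensor.{u, v, max u v} C(X, ℂ) A) :=
  ⟨{ carrier := C(X, A)
     ι := tensorToCont X A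
     injective := tensorToCont_injective
     denseRange := tensorToCont_denseRange }⟩

variable {T : CStarTensor.{u, v, w} C(X, ℂ) A} {π : T.carrier ≃⋆ₐ[ℂ] C(X, A)}

lemma isCanonical_iff : IsCanonical T π ↔ ∀ t, π (T.ι t) = tensorToCont X A t := by
  constructor
  · intro h t
    induction t with
    | zero => simp
    | add s t hs ht => rw [map_add, map_add, hs, ht, map_add]
    | tmul f a => exact ContinuousMap.ext fun x => h f a x
  · intro h f a x
    rw [h]
    rfl

lemma existsUnique_isCanonical {I : ℕ → StarSubalgebra ℂ A} [∀ n, FiniteDimensional ℂ (I n)]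
    (hI : Monotone I) (hd : closure (⋃ n, (I n : Set A)) = Set.univ)
    (T : CStarTensor.{u, v, w} C(X, ℂ) A) :
    ∃! π : T.carrier ≃⋆ₐ[ℂ] C(X, A), IsCanonical T π := by
  obtain ⟨π, hπ⟩ := exists_starAlgEquiv_of_norm_eq T.ι (tensorToCont X A) T.denseRange
    tensorToCont_denseRange (norm_eq_norm_tensorToCont hI hd T.injective)
  refine ⟨π, isCanonical_iff.mpr hπ, fun π' hπ' => DFunLike.ext' ?_⟩
  refine T.denseRange.equalizer (StarAlgEquiv.isometry π').continuous
    (StarAlgEquiv.isometry π).continuous (funext fun t => ?_)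
  exact (isCanonical_iff.mp hπ' t).trans (hπ t).symm

lemma isModel_starAlgEquiv (π : T.carrier ≃⋆ₐ[ℂ] C(X, A)) : IsModel π.toStarAlgHom ⊤ where
  injective := EquivLike.injective π
  apply_mem _ _ := trivial
  exists_eq f _ := ⟨π.symm f, π.apply_symm_apply f⟩

variable (X) in
/-- The functions with values in a *-subalgebra. -/
def contSubalgebra (S : StarSubalgebra ℂ A) : StarSubalgebra ℂ C(X, A) where
  carrier := {f | ∀ x, f x ∈ S}
  mul_mem' hf hg x := mul_mem (hf x) (hg x)
  one_mem' _ := one_mem S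
  add_mem' hf hg x := add_mem (hf x) (hg x)
  zero_mem' _ := zero_mem S
  algebraMap_mem' r _ := S.algebraMap_mem r
  star_mem' hf x := star_mem (hf x)

lemma isClosed_contSubalgebra (S : StarSubalgebra ℂ A) (hS : IsClosed (S : Set A)) :
    IsClosed (contSubalgebra X S : Set C(X, A)) := by
  change IsClosed {f : C(X, A) | ∀ x, f x ∈ (S : Set A)}
  rw [Set.ofPred_forall]
  exact isClosed_iInter fun x => hS.preimage (continuous_eval_const x)

/-- The functions with values in `S` form a closed *-subalgebra containing the generators.
Conversely, partition-of-unity sums approximate such a function with coefficients among its own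
values. -/
lemma isModel_sub (hπ : IsCanonical T π) (S : StarSubalgebra ℂ A) [hS : IsClosed (S : Set A)] :
    IsModel (π.toStarAlgHom.comp (T.sub S).subtype) S where
  injective := (EquivLike.injective π).comp Subtype.val_injective
  apply_mem := by
    have hle : T.sub S ≤ (contSubalgebra X S).comap π.toStarAlgHom := by
      refine StarSubalgebra.topologicalClosure_minimal (StarAlgebra.adjoin_le ?_) ?_
      · rintro _ ⟨f, s, hs, rfl⟩ x
        change π (T.ι (f ⊗ₜ[ℂ] s)) x ∈ S
        rw [hπ]
        exact S.smul_mem hs _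
      · exact (isClosed_contSubalgebra S hS).preimage (StarAlgEquiv.isometry π).continuous
    exact fun d x => hle d.2 x
  exists_eq f hf := by
    suffices h : π.symm f ∈ T.sub S from ⟨⟨_, h⟩, π.apply_symm_apply f⟩
    change π.symm f ∈ closure _
    rw [Metric.mem_closure_iff]
    intro ε hε
    obtain ⟨s, ψ, b, -, -, hb, h⟩ := exists_elementary_approx_of_forall f S (half_pos hε)
      fun x => ⟨f x, hf x, by simpa using (half_pos (half_pos hε)).le⟩
    refine ⟨T.ι (∑ i ∈ s, ψ i ⊗ₜ[ℂ] b i), ?_, ?_⟩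
    · rw [map_sum]
      exact sum_mem fun i _ => StarAlgebra.subset_adjoin ℂ _ ⟨ψ i, b i, hb i, rfl⟩
    · rw [← (StarAlgEquiv.isometry π).dist_eq, π.apply_symm_apply, isCanonical_iff.mp hπ, map_sum,
        dist_eq_norm]
      exact h.trans_lt (half_lt_self hε)

variable {τ : StateSpace A} {I : ℕ → StarSubalgebra ℂ A} {β : ℕ → ℝ}

lemma tensorSeminorm_tmul (hπ : IsCanonical T π) (f : C(X, ℂ)) (a : A) :
    tensorSeminorm τ I β T π (T.ι (f ⊗ₜ[ℂ] a)) =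
      lipSeminorm f * ‖a‖ₑ + afSeminorm τ I β a * ‖f‖ₑ := by
  rw [tensorSeminorm, isCanonical_iff.mp hπ, tensorToCont_tmul, ahSeminorm_elementary]

variable [∀ n, FiniteDimensional ℂ (I n)] [Nonempty X] (h : IsAFData τ I β)
include h

lemma isCQMS_tensorPair (π : T.carrier ≃⋆ₐ[ℂ] C(X, A)) :
    (tensorPair τ I β T π).IsCQMS 2 := by
  have := (isModel_starAlgEquiv π).isCQMS h h.isApproximated_top
  exact this

lemma isCQMS_tensorSubPair (hπ : IsCanonical T π) (n : ℕ) :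
    (tensorSubPair τ I β T π (I n)).IsCQMS 2 := by
  have := (isModel_sub hπ (I n)).isCQMS h (isApproximated_self I n)
  exact this

lemma propinquity_tensorPair_le (hπ : IsCanonical T π) (n : ℕ) :
    propinquity 2 (tensorPair τ I β T π) (tensorSubPair τ I β T π (I n)) ≤
      ENNReal.ofReal (β n) := by
  have := propinquity_le_of_isModel h (isModel_starAlgEquiv π) (T.sub (I n)).subtype n
    (isModel_sub hπ (I n))
  exact this

end CanonicalIso

/-! ### Full quantum isometries -/

section Isometries

lemma QPair.FullyQuantumIsometric.trans {P : QPair.{u}} {Q : QPair.{v}} {R : QPair.{w}}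
    (h1 : P.FullyQuantumIsometric Q) (h2 : Q.FullyQuantumIsometric R) :
    P.FullyQuantumIsometric R := by
  obtain ⟨π, hπ⟩ := h1
  obtain ⟨ρ, hρ⟩ := h2
  exact ⟨π.trans ρ, fun a => (hρ _).trans (hπ a)⟩

variable {X : Type u} [MetricSpace X] [CompactSpace X] {A : Type v} [CStarAlgebra A]
  {τ : StateSpace A} {I : ℕ → StarSubalgebra ℂ A} {β : ℕ → ℝ}

lemma tensorPair_fullyQuantumIsometric (T : CStarTensor.{u, v, w} C(X, ℂ) A)
    (π : T.carrier ≃⋆ₐ[ℂ] C(X, A)) :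
    (tensorPair τ I β T π).FullyQuantumIsometric (contPair X τ I β) :=
  ⟨π, fun _ => rfl⟩

variable [∀ n, FiniteDimensional ℂ (I n)] (h : IsAFData τ I β)
include h

/-- Every element of `A` is a scalar, so `L^β` vanishes and only the Lipschitz part remains. -/
lemma contPair_fullyQuantumIsometric_of_equiv_complex (e : A ≃⋆ₐ[ℂ] ℂ) :
    (contPair X τ I β).FullyQuantumIsometric (QPair.of C(X, ℂ) lipSeminorm) := by
  have he := StarAlgEquiv.isometry e
  have he' := StarAlgEquiv.isometry e.symm
  let π : C(X, A) ≃⋆ₐ[ℂ] C(X, ℂ) :=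
    { toFun := fun f => ⟨fun x => e (f x), he.continuous.comp f.continuous⟩
      invFun := fun f => ⟨fun x => e.symm (f x), he'.continuous.comp f.continuous⟩
      left_inv := fun f => ContinuousMap.ext fun x => e.symm_apply_apply (f x)
      right_inv := fun f => ContinuousMap.ext fun x => e.apply_symm_apply (f x)
      map_mul' := fun f g => ContinuousMap.ext fun x => map_mul e (f x) (g x)
      map_add' := fun f g => ContinuousMap.ext fun x => map_add e (f x) (g x)
      map_star' := fun f => ContinuousMap.ext fun x => map_star e (f x)
      map_smul' := fun c f => ContinuousMap.ext fun x => map_smul e c (f x) }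
  have haf : ∀ a : A, afSeminorm τ I β a = 0 := by
    intro a
    have : a = e a • (1 : A) := by
      rw [← (EquivLike.injective e).eq_iff, map_smul, map_one, smul_eq_mul, mul_one]
    rw [this]
    exact afSeminorm_smul_one h.faithful h.tracial _
  refine ⟨π, fun (f : selfAdjoint C(X, A)) => ?_⟩
  change lipSeminorm (π f) = ahSeminorm τ I β (f : C(X, A))
  rw [ahSeminorm_eq, ENNReal.iSup_eq_zero.mpr fun x => haf _, add_zero]
  refine lipSeminorm_congr fun x y => ?_
  change ‖e _ - e _‖ = _
  rw [← dist_eq_norm, he.dist_eq, dist_eq_norm]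

omit h [∀ n, FiniteDimensional ℂ (I n)] in
lemma contPair_fullyQuantumIsometric_of_subsingleton [Nonempty X] [Subsingleton X] :
    (contPair X τ I β).FullyQuantumIsometric (QPair.of A (afSeminorm τ I β)) := by
  obtain ⟨x₀⟩ := ‹Nonempty X›
  let π : C(X, A) ≃⋆ₐ[ℂ] A :=
    { toFun := fun f => f x₀
      invFun := fun a => ContinuousMap.const X a
      left_inv := fun f => ContinuousMap.ext fun x => congrArg f (Subsingleton.elim x₀ x)
      right_inv := fun _ => rfl
      map_mul' := fun _ _ => rfl
      map_add' := fun _ _ => rfl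
      map_star' := fun _ => rfl
      map_smul' := fun _ _ => rfl }
  refine ⟨π, fun (f : selfAdjoint C(X, A)) => ?_⟩
  change afSeminorm τ I β ((f : C(X, A)) x₀) = ahSeminorm τ I β (f : C(X, A))
  rw [ahSeminorm_eq, lipSeminorm_eq_zero_iff.mpr fun x y =>
    congrArg (f : C(X, A)) (Subsingleton.elim x y), zero_add]
  refine le_antisymm (le_iSup (fun x => afSeminorm τ I β ((f : C(X, A)) x)) x₀)
    (iSup_le fun x => ?_)
  rw [Subsingleton.elim x x₀]

lemma contPair_fullyQuantumIsometric_of_eq_top (htop : ∀ n, n ≠ 0 → I n = ⊤) :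
    (contPair X τ I β).FullyQuantumIsometric
      (QPair.of C(X, A) (homSeminorm (condExpX τ (I 0)) (β 0))) := by
  refine ⟨.refl ℂ C(X, A), fun (f : selfAdjoint C(X, A)) => ?_⟩
  change homSeminorm (condExpX τ (I 0)) (β 0) (f : C(X, A)) = ahSeminorm τ I β (f : C(X, A))
  rw [homSeminorm, ahSeminorm]
  congr 1
  refine le_antisymm (le_iSup (fun n => ‖(f : C(X, A)) -
    inclX (I n) (condExpX τ (I n) (f : C(X, A)))‖ₑ / ENNReal.ofReal (β n)) 0)
    (iSup_le fun n => ?_)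
  rcases eq_or_ne n 0 with rfl | hn
  · exact le_rfl
  · have : (f : C(X, A)) - inclX (I n) (condExpX τ (I n) (f : C(X, A))) = 0 :=
      ContinuousMap.ext fun x => sub_condExp_eq_zero h.faithful h.tracial h.mono
        (m := n) (by rw [htop n hn]; trivial) le_rfl
    rw [this]
    simp

end Isometries

theorem theoremt
    {X : Type u} [MetricSpace X] [CompactSpace X] [Nonempty X]
    {A : Type v} [CStarAlgebra A]
    (τ : StateSpace A) (hτ_tracial : τ.IsTracial) (hτ_faithful : τ.IsFaithful)
    (I : ℕ → StarSubalgebra ℂ A) [∀ n, FiniteDimensional ℂ (I n)]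
    (hI_zero : I 0 = ⊥) (hI_mono : Monotone I)
    (hI_dense : closure (⋃ n, (I n : Set A)) = Set.univ)
    (β : ℕ → ℝ) (hβ_pos : ∀ n, 0 < β n) (hβ_lim : Tendsto β atTop (𝓝 0)) :
    -- the conditional expectations are well defined
    (∀ n, ∃! E : A →L[ℂ] I n, IsPreservingCondExp τ (I n) E) ∧
    -- (1)
    (∀ n, (contSubPair X τ I β (I n)).IsCQMS 2 ∧
      ∀ f : C(X, I n), IsSelfAdjoint f →
        ahSeminorm τ I β (inclX (I n) f) = lipSeminorm f +
          (Finset.range (n + 1)).sup fun k =>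
            ‖inclX (I n) f - inclX (I k) (condExpX τ (I k) (inclX (I n) f))‖ₑ /
              ENNReal.ofReal (β k)) ∧
    -- (2)
    (contPair X τ I β).IsCQMS 2 ∧
    -- (3)
    (∀ n, propinquity 2 (contPair X τ I β) (contSubPair X τ I β (I n)) ≤ ENNReal.ofReal (β n)) ∧
    Tendsto (fun n => propinquity 2 (contPair X τ I β) (contSubPair X τ I β (I n)))
      atTop (𝓝 0) ∧
    -- (4)
    (Nonempty (A ≃⋆ₐ[ℂ] ℂ) →
      (contPair X τ I β).FullyQuantumIsometric (QPair.of C(X, ℂ) lipSeminorm)) ∧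
    -- (5)
    (Subsingleton X →
      (contPair X τ I β).FullyQuantumIsometric (QPair.of A (afSeminorm τ I β))) ∧
    -- (6)
    (∀ r : ℝ, 0 < r → FiniteDimensional ℂ A → (∀ n, n ≠ 0 → I n = ⊤) → β 0 = r →
      (contPair X τ I β).FullyQuantumIsometric
        (QPair.of C(X, A) (homSeminorm (condExpX τ (I 0)) r))) ∧
    -- the C*-algebraic tensor product exists, and the canonical *-isomorphism is well defined
    Nonempty (CStarTensor.{u, v, max u v} C(X, ℂ) A) ∧
    ∀ T : CStarTensor.{u, v, max u v} C(X, ℂ) A,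
      (∃! π : T.carrier ≃⋆ₐ[ℂ] C(X, A), IsCanonical T π) ∧
      ∀ π : T.carrier ≃⋆ₐ[ℂ] C(X, A), IsCanonical T π →
        -- (1) for the tensor product
        (∀ n, (tensorSubPair τ I β T π (I n)).IsCQMS 2) ∧
        -- (2) for the tensor product
        (tensorPair τ I β T π).IsCQMS 2 ∧
        -- (3) for the tensor product
        (∀ n, propinquity 2 (tensorPair τ I β T π) (tensorSubPair τ I β T π (I n)) ≤
          ENNReal.ofReal (β n)) ∧
        Tendsto (fun n => propinquity 2 (tensorPair τ I β T π) (tensorSubPair τ I β T π (I n)))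
          atTop (𝓝 0) ∧
        -- (4) for the tensor product
        (Nonempty (A ≃⋆ₐ[ℂ] ℂ) →
          (tensorPair τ I β T π).FullyQuantumIsometric (QPair.of C(X, ℂ) lipSeminorm)) ∧
        -- (5) for the tensor product
        (Subsingleton X →
          (tensorPair τ I β T π).FullyQuantumIsometric (QPair.of A (afSeminorm τ I β))) ∧
        -- (6) for the tensor product
        (∀ r : ℝ, 0 < r → FiniteDimensional ℂ A → (∀ n, n ≠ 0 → I n = ⊤) → β 0 = r →
          (tensorPair τ I β T π).FullyQuantumIsometric
            (QPair.of C(X, A) (homSeminorm (condExpX τ (I 0)) r))) ∧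
        -- the Leibniz rule on elementary tensors
        (∀ (f : C(X, ℂ)) (a : A),
          tensorSeminorm τ I β T π (T.ι (f ⊗ₜ[ℂ] a)) =
            lipSeminorm f * ‖a‖ₑ + afSeminorm τ I β a * ‖f‖ₑ) ∧
        (∀ a : A, tensorSeminorm τ I β T π (T.ι ((1 : C(X, ℂ)) ⊗ₜ[ℂ] a)) = afSeminorm τ I β a) ∧
        (∀ f : C(X, ℂ), tensorSeminorm τ I β T π (T.ι (f ⊗ₜ[ℂ] (1 : A))) = lipSeminorm f) := by
  have h : IsAFData τ I β :=
    ⟨hτ_tracial, hτ_faithful, hI_zero, hI_mono, hI_dense, hβ_pos, hβ_lim⟩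
  have hlim : Tendsto (fun n => ENNReal.ofReal (β n)) atTop (𝓝 0) := by
    simpa using ENNReal.tendsto_ofReal hβ_lim
  have h6 : ∀ r : ℝ, 0 < r → FiniteDimensional ℂ A → (∀ n, n ≠ 0 → I n = ⊤) → β 0 = r →
      (contPair X τ I β).FullyQuantumIsometric
        (QPair.of C(X, A) (homSeminorm (condExpX τ (I 0)) r)) := by
    rintro r - - htop rfl
    exact contPair_fullyQuantumIsometric_of_eq_top h htop
  refine ⟨fun n => existsUnique_isPreservingCondExp hτ_faithful hτ_tracial,
    fun n => ⟨isCQMS_contSubPair h n, fun f _ => ahSeminorm_inclX_eq h n f⟩,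
    isCQMS_contPair h, propinquity_contPair_le h,
    tendsto_of_tendsto_of_tendsto_of_le_of_le tendsto_const_nhds hlim (fun _ => zero_le)
      (propinquity_contPair_le h),
    fun ⟨e⟩ => contPair_fullyQuantumIsometric_of_equiv_complex h e,
    fun _ => contPair_fullyQuantumIsometric_of_subsingleton, h6, nonempty_cstarTensor X A,
    fun T => ⟨existsUnique_isCanonical hI_mono hI_dense T, fun π hπ => ?_⟩⟩
  have hiso := tensorPair_fullyQuantumIsometric (τ := τ) (I := I) (β := β) T π
  -- `τ(1) = 1` excludes the zero algebra, so `‖1‖ = 1` in `A`, as the formula for `f ⊗ 1` needs.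
  have : Nontrivial A := ⟨1, 0, fun h10 => by
    have h1 := τ.2.1
    rw [h10, map_zero] at h1
    exact zero_ne_one h1⟩
  refine ⟨isCQMS_tensorSubPair h hπ, isCQMS_tensorPair h π, propinquity_tensorPair_le h hπ,
    tendsto_of_tendsto_of_tendsto_of_le_of_le tendsto_const_nhds hlim (fun _ => zero_le)
      (propinquity_tensorPair_le h hπ),
    fun ⟨e⟩ => hiso.trans (contPair_fullyQuantumIsometric_of_equiv_complex h e),
    fun _ => hiso.trans contPair_fullyQuantumIsometric_of_subsingleton,
    fun r hr hA htop hβ => hiso.trans (h6 r hr hA htop hβ),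
    tensorSeminorm_tmul hπ, fun a => ?_, fun f => ?_⟩
  · rw [tensorSeminorm_tmul hπ, lipSeminorm_eq_zero_iff.mpr fun _ _ => rfl, zero_mul, zero_add,
      ← ofReal_norm, norm_one, ENNReal.ofReal_one, mul_one]
  · have h0 := afSeminorm_smul_one (β := β) (I := I) hτ_faithful hτ_tracial 1
    rw [one_smul] at h0
    rw [tensorSeminorm_tmul hπ, h0, zero_mul, add_zero, ← ofReal_norm, norm_one,
      ENNReal.ofReal_one, mul_one]
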